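/- Let $K$ be a field of characteristic $0$, complete with respect to a nontrivial nonarchimedean absolute value. By a manifold we mean a paracompact Hausdorff finite-dimensional locally $K$-analytic manifold (in a fixed universe); $\mathbf{La}$ is the category of manifolds and locally analytic maps, with the Grothendieck topology generated by open coverings. Let $G$ be a locally $K$-analytic Lie group, $y(G)$ the sheaf of groups on $\mathbf{La}$ it represents, and $BG$ the topos of sheaves on $\mathbf{La}$ with an action of $y(G)$. Abelian group objects of $BG$ are sheaves of abelian groups on $\mathbf{La}$ with an additive action of $y(G)$; for such an $\mathcal A$ put $H^i(G,\mathcal A):=(R^i\Gamma)(\mathcal A)$, where $\Gamma(\mathcal A)=\operatorname{Hom}_{BG}(*,\mathcal A)$. Let $V$ be a Hausdorff locally convex $K$-vector space. A function $f$ from a manifold $X$ to $V$ is called analytic if every point of $X$ has an open neighbourhood $U$ such that $f|_U$ factors through an analytic map $U\to W$ to a $K$-Banach space $W$ with a continuous linear injection $W\hookrightarrow V$. Let $G$ act on $V$ by continuous linear automorphisms such that all orbit maps $G\to V$, $g\mapsto gv$, are analytic (a locally analytic representation). Let $\underline V$ be the sheaf whose sections over $X$ are the admissible functions, i.e. the analytic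 functions $f\colon X\to V$ such that $G\times X\to V$, $(g,x)\mapsto g f(x)$, is analytic; $y(G)$ acts on $\underline V$ by $(\rho f)(x)=\rho(x)f(x)$, so that $\underline V$ is an abelian group object of $BG$. Put $H^i_{\mathrm{an}}(G,V):=H^i(G,\underline V)$; the scalars $c\in K$ act on it through multiplication by $c$ on $\underline V$. Let $C^{\mathrm{an}}_G(E_\bullet G,V)$ be the complex which in degree $p\ge 0$ consists of the analytic functions $f\colon G^{p+1}\to V$ with $f(gg_0,\dots,gg_p)=g f(g_0,\dots,g_p)$ for all $g,g_0,\dots,g_p\in G$, with differential $(df)(g_0,\dots,g_{p+1})=\sum_{j=0}^{p+1}(-1)^j f(g_0,\dots,\widehat{g_j},\dots,g_{p+1})$. Then for every $i\ge 0$ there is a $K$-linear isomorphism \[ H^i_{\mathrm{an}}(G,V)\;\cong\;H^i\bigl(C^{\mathrm{an}}_G(E_\bullet G,V)\bigr). \] -/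

import Mathlib

open CategoryTheory Opposite

universe v' u' v u

namespace LocAnCoh

section EquivariantSheaves

theorem enoughInjectives_sheaf {C : Type u} [Category.{v} C] (J : GrothendieckTopology C) :
    EnoughInjectives (Sheaf J AddCommGrpCat.{max u v}) := by
  have : EssentiallySmall.{max u v} C := inferInstance
  have := Sheaf.isGrothendieckAbelian_of_essentiallySmall.{max u v} J AddCommGrpCat.{max u v}
  infer_instance

variable {C : Type u} [Category.{v} C]

/-- A sheaf `F` on the site `(C, J)` with values in `D`, together with an action of the presheaf of
groups `𝒢`: for every `X` the group `𝒢(X)` acts on `F(X)` from the left, compatibly with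
restriction. For `D` the category of types this is an object of the classifying topos `B𝒢`; for
`D` the category of abelian groups it is an abelian group object of `B𝒢`. -/
structure EquivariantSheaf (J : GrothendieckTopology C) (𝒢 : Cᵒᵖ ⥤ GrpCat.{v})
    (D : Type u') [Category.{v'} D] where
  sheaf : Sheaf J D
  act (X : Cᵒᵖ) : 𝒢.obj X →* End (sheaf.obj.obj X)
  act_map {X Y : Cᵒᵖ} (f : X ⟶ Y) (g : 𝒢.obj X) :
    (act X g : sheaf.obj.obj X ⟶ sheaf.obj.obj X) ≫ sheaf.obj.map f =
      sheaf.obj.map f ≫ act Y (𝒢.map f g)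

namespace EquivariantSheaf

variable {J : GrothendieckTopology C} {𝒢 : Cᵒᵖ ⥤ GrpCat.{v}} {D : Type u'} [Category.{v'} D]

/-- Morphisms of sheaves with `𝒢`-action: the equivariant morphisms of sheaves. -/
@[ext]
structure Hom (A B : EquivariantSheaf J 𝒢 D) where
  hom : A.sheaf ⟶ B.sheaf
  comm (X : Cᵒᵖ) (g : 𝒢.obj X) :
    (A.act X g : A.sheaf.obj.obj X ⟶ A.sheaf.obj.obj X) ≫ hom.hom.app X =
      hom.hom.app X ≫ B.act X g

instance : Category (EquivariantSheaf J 𝒢 D) where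
  Hom := Hom
  id A := ⟨𝟙 _, by intros; simp⟩
  comp f g := ⟨f.hom ≫ g.hom, fun X x => by
    have h1 := f.comm X x
    have h2 := g.comm X x
    simp only [ObjectProperty.FullSubcategory.comp_hom, NatTrans.comp_app, Category.assoc]
    rw [← h2, reassoc_of% h1]⟩

@[ext]
theorem hom_ext {A B : EquivariantSheaf J 𝒢 D} {f g : A ⟶ B} (h : f.hom = g.hom) : f = g :=
  Hom.ext h

@[simp] theorem id_hom (A : EquivariantSheaf J 𝒢 D) : Hom.hom (𝟙 A) = 𝟙 A.sheaf := rfl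

@[simp] theorem comp_hom {A B E : EquivariantSheaf J 𝒢 D} (f : A ⟶ B) (g : B ⟶ E) :
    (f ≫ g).hom = f.hom ≫ g.hom := rfl

section Preadditive

variable [Preadditive D] (A B : EquivariantSheaf J 𝒢 D)

instance : Zero (A ⟶ B) := ⟨⟨0, by intros; simp⟩⟩
instance : Add (A ⟶ B) := ⟨fun f g => ⟨f.hom + g.hom, fun X x =>
  (Preadditive.comp_add _ _ _ _ (f.hom.hom.app X) (g.hom.hom.app X)).trans <|
    (congrArg₂ (· + ·) (f.comm X x) (g.comm X x)).trans
      (Preadditive.add_comp _ _ _ _ _ _).symm⟩⟩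
instance : Neg (A ⟶ B) := ⟨fun f => ⟨-f.hom, fun X x =>
  (Preadditive.comp_neg _ (f.hom.hom.app X)).trans <|
    (congrArg (- ·) (f.comm X x)).trans (Preadditive.neg_comp _ _).symm⟩⟩
instance : Sub (A ⟶ B) := ⟨fun f g => ⟨f.hom - g.hom, fun X x =>
  (Preadditive.comp_sub _ (f.hom.hom.app X) (g.hom.hom.app X)).trans <|
    (congrArg₂ (· - ·) (f.comm X x) (g.comm X x)).trans (Preadditive.sub_comp _ _ _).symm⟩⟩
instance : SMul ℕ (A ⟶ B) := ⟨fun n f => ⟨n • f.hom, fun X x =>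
  (Preadditive.comp_nsmul _ (f.hom.hom.app X) n).trans <|
    (congrArg (n • ·) (f.comm X x)).trans (Preadditive.nsmul_comp _ _ _).symm⟩⟩
instance : SMul ℤ (A ⟶ B) := ⟨fun n f => ⟨n • f.hom, fun X x =>
  (Preadditive.comp_zsmul _ (f.hom.hom.app X) n).trans <|
    (congrArg (n • ·) (f.comm X x)).trans (Preadditive.zsmul_comp _ _ _).symm⟩⟩

instance : AddCommGroup (A ⟶ B) :=
  Function.Injective.addCommGroup (fun f : A ⟶ B => f.hom) (fun _ _ h => hom_ext h) rfl
    (fun _ _ => rfl) (fun _ => rfl) (fun _ _ => rfl) (fun _ _ => rfl) (fun _ _ => rfl)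

@[simp] theorem add_hom {A B : EquivariantSheaf J 𝒢 D} (f g : A ⟶ B) :
    (f + g).hom = f.hom + g.hom := rfl

instance : Preadditive (EquivariantSheaf J 𝒢 D) where
  add_comp _ _ _ f g h := by ext1; simp [Preadditive.add_comp]
  comp_add _ _ _ f g h := by ext1; simp [Preadditive.comp_add]

end Preadditive

end EquivariantSheaf

/-! The category of sheaves with `𝒢`-action is equivalent to a category of sheaves on a site: the
site has the same objects as `C`, but morphisms are twisted by sections of `𝒢`. This is only used
to see that abelian sheaves with `𝒢`-action form an abelian category with enough injectives. -/

structure Twist (𝒢 : Cᵒᵖ ⥤ GrpCat.{v}) where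
  base : C

namespace Twist

variable {𝒢 : Cᵒᵖ ⥤ GrpCat.{v}}

@[ext]
structure Hom (X Y : Twist 𝒢) where
  base : X.base ⟶ Y.base
  tw : 𝒢.obj (op X.base)

instance : Category (Twist 𝒢) where
  Hom := Hom
  id X := ⟨𝟙 _, 1⟩
  comp f g := ⟨f.base ≫ g.base, f.tw * 𝒢.map f.base.op g.tw⟩
  id_comp f := by apply Hom.ext <;> simp
  comp_id f := by apply Hom.ext <;> simp
  assoc f g h := by apply Hom.ext <;> simp [mul_assoc]

def homMk {X Y : Twist 𝒢} (f : X.base ⟶ Y.base) (g : 𝒢.obj (op X.base)) : X ⟶ Y := ⟨f, g⟩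

@[simp] theorem homMk_base {X Y : Twist 𝒢} (f : X.base ⟶ Y.base) (g : 𝒢.obj (op X.base)) :
    (homMk f g : X ⟶ Y).base = f := rfl
@[simp] theorem homMk_tw {X Y : Twist 𝒢} (f : X.base ⟶ Y.base) (g : 𝒢.obj (op X.base)) :
    (homMk f g : X ⟶ Y).tw = g := rfl

@[ext]
theorem hom_ext {X Y : Twist 𝒢} {f g : X ⟶ Y} (h : f.base = g.base) (h' : f.tw = g.tw) : f = g :=
  Hom.ext h h'

@[simp] theorem id_base (X : Twist 𝒢) : Hom.base (𝟙 X) = 𝟙 X.base := rfl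
@[simp] theorem id_tw (X : Twist 𝒢) : Hom.tw (𝟙 X) = 1 := rfl
@[simp] theorem comp_base {X Y Z : Twist 𝒢} (f : X ⟶ Y) (g : Y ⟶ Z) :
    (f ≫ g).base = f.base ≫ g.base := rfl
@[simp] theorem comp_tw {X Y Z : Twist 𝒢} (f : X ⟶ Y) (g : Y ⟶ Z) :
    (f ≫ g).tw = f.tw * 𝒢.map f.base.op g.tw := rfl

variable (𝒢) in
def incl : C ⥤ Twist 𝒢 where
  obj X := ⟨X⟩
  map f := homMk f 1
  map_id X := rfl
  map_comp f g := by ext <;> simp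

/-- Sieves do not see the twists. -/
theorem mem_of_base_eq {X Y : Twist 𝒢} {S : Sieve X} {f f' : Y ⟶ X} (h : f.base = f'.base)
    (hf : S f) : S f' := by
  have : f' = (Twist.homMk (𝟙 _) (f'.tw * f.tw⁻¹) : Y ⟶ Y) ≫ f := by
    ext <;> simp [h]
  rw [this]
  exact S.downward_closed hf _

variable (𝒢) in
/-- A sieve is covering if its untwisted part is covering. -/
def topology (J : GrothendieckTopology C) : GrothendieckTopology (Twist 𝒢) where
  sieves X := { S | Sieve.functorPullback (incl 𝒢) (X := X.base) S ∈ J X.base }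
  top_mem' X := J.top_mem X.base
  pullback_stable' X Y S f hS := by
    refine J.superset_covering ?_ (J.pullback_stable f.base hS)
    intro Z g hg
    exact mem_of_base_eq (S := S) (f := (incl 𝒢).map (g ≫ f.base)) rfl hg
  transitive' X S hS R hR := by
    refine J.transitive hS _ fun Y f hf => ?_
    refine J.superset_covering ?_ (hR (Y := ⟨Y⟩) (f := (incl 𝒢).map f) hf)
    intro Z g hg
    exact mem_of_base_eq (S := R) (f := (incl 𝒢).map g ≫ ((incl 𝒢).map f : _ ⟶ X)) rfl hg

end Twist

namespace EquivariantSheaf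

variable {J : GrothendieckTopology C} {𝒢 : Cᵒᵖ ⥤ GrpCat.{v}} {D : Type u'} [Category.{v'} D]

def toPresheaf (A : EquivariantSheaf J 𝒢 D) : (Twist 𝒢)ᵒᵖ ⥤ D where
  obj X := A.sheaf.obj.obj (op X.unop.base)
  map f := A.sheaf.obj.map f.unop.base.op ≫ A.act _ f.unop.tw
  map_id X := by simp [End.one_def]
  map_comp f g := by
    have := A.act_map g.unop.base.op f.unop.tw
    simp [End.mul_def, reassoc_of% this]

theorem toPresheaf_map_incl (A : EquivariantSheaf J 𝒢 D) {X Y : C} (f : X ⟶ Y) :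
    A.toPresheaf.map ((Twist.incl 𝒢).map f).op = A.sheaf.obj.map f.op := by
  simp [toPresheaf, Twist.incl, End.one_def]

/-- The presheaf `A.toPresheaf` is a sheaf. -/
theorem toPresheaf_isSheaf (A : EquivariantSheaf J 𝒢 D) :
    Presheaf.IsSheaf (Twist.topology 𝒢 J) A.toPresheaf := by
  intro E X S hS x hx
  have key := A.sheaf.property E _ hS
  have hx' : ∀ {Y₁ Y₂ Z : Twist 𝒢} (g₁ : Z ⟶ Y₁) (g₂ : Z ⟶ Y₂) {f₁ : Y₁ ⟶ X} {f₂ : Y₂ ⟶ X}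
      (h₁ : S f₁) (h₂ : S f₂), g₁ ≫ f₁ = g₂ ≫ f₂ →
      (x f₁ h₁ : E ⟶ A.toPresheaf.obj (op Y₁)) ≫ A.toPresheaf.map g₁.op =
      (x f₂ h₂ : E ⟶ A.toPresheaf.obj (op Y₂)) ≫ A.toPresheaf.map g₂.op :=
    fun g₁ g₂ _ _ h₁ h₂ h => hx g₁ g₂ h₁ h₂ h
  let y : Presieve.FamilyOfElements (A.sheaf.obj ⋙ coyoneda.obj (op E))
      (Sieve.functorPullback (Twist.incl 𝒢) (X := X.base) S).arrows :=
    fun Y f hf => x (Y := ⟨Y⟩) ((Twist.incl 𝒢).map f) hf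
  have hy : y.Compatible := by
    intro Y₁ Y₂ Z g₁ g₂ f₁ f₂ h₁ h₂ h
    have := hx' (Z := ⟨Z⟩) ((Twist.incl 𝒢).map g₁) ((Twist.incl 𝒢).map g₂) h₁ h₂ (by
      apply Twist.hom_ext
      · exact h
      · simp [Twist.incl])
    erw [toPresheaf_map_incl, toPresheaf_map_incl] at this
    exact this
  obtain ⟨t, ht, ht'⟩ := key y hy
  refine ⟨t, fun Y f hf => ?_, fun t' h' => ht' t' fun Y f hf => ?_⟩
  · have hf' : S (Y := ⟨Y.base⟩) ((Twist.incl 𝒢).map f.base) :=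
      Twist.mem_of_base_eq (S := S) (f := f) rfl hf
    have h1 : (t : E ⟶ A.sheaf.obj.obj (op X.base)) ≫ A.sheaf.obj.map f.base.op =
        x (Y := ⟨Y.base⟩) ((Twist.incl 𝒢).map f.base) hf' :=
      ht f.base hf'
    have h2 := hx' (Z := Y) (Y₁ := Y) (Twist.homMk (𝟙 _) (f.tw) : Y ⟶ Y) (𝟙 _)
      (f₁ := (Twist.incl 𝒢).map f.base) (f₂ := f)
      hf' hf (by
        apply Twist.hom_ext
        · rfl
        · simp [Twist.incl])
    rw [op_id, A.toPresheaf.map_id, Category.comp_id] at h2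
    have h3 : (t : E ⟶ A.toPresheaf.obj (op X)) ≫ A.toPresheaf.map f.op = x f hf := by
      rw [← h2]
      erw [← h1]
      simp [toPresheaf]
    exact h3
  · have h1 : (t' : E ⟶ A.toPresheaf.obj (op X)) ≫
        A.toPresheaf.map (Quiver.Hom.op (X := ⟨Y⟩) ((Twist.incl 𝒢).map f)) =
        x (Y := ⟨Y⟩) ((Twist.incl 𝒢).map f) hf := h' _ hf
    erw [toPresheaf_map_incl] at h1
    exact h1

variable (J 𝒢 D) in
def toSheafTwist : EquivariantSheaf J 𝒢 D ⥤ Sheaf (Twist.topology 𝒢 J) D where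
  obj A := ⟨A.toPresheaf, A.toPresheaf_isSheaf⟩
  map {A B} f := ⟨{
    app X := f.hom.hom.app (op X.unop.base)
    naturality X Y g := by
      have := f.comm (op Y.unop.base) g.unop.tw
      simp [toPresheaf, this] }⟩

instance : (toSheafTwist J 𝒢 D).Faithful where
  map_injective {A B} f g h := by
    ext X
    have := congrArg (fun (k : (toSheafTwist J 𝒢 D).obj A ⟶ (toSheafTwist J 𝒢 D).obj B) =>
      k.hom.app (op ⟨X.unop⟩)) h
    exact this

instance : (toSheafTwist J 𝒢 D).Full where
  map_surjective {A B} f := by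
    refine ⟨⟨⟨{ app X := f.hom.app (op ⟨X.unop⟩), naturality X Y g := ?_ }⟩, fun X g => ?_⟩, ?_⟩
    · have := f.hom.naturality (X := op ⟨X.unop⟩) (Y := op ⟨Y.unop⟩) ((Twist.incl 𝒢).map g.unop).op
      erw [toPresheaf_map_incl, toPresheaf_map_incl] at this
      exact this
    · have := f.hom.naturality (X := op ⟨X.unop⟩) (Y := op ⟨X.unop⟩)
        (Quiver.Hom.op (Twist.homMk (𝟙 _) (g) : (⟨X.unop⟩ : Twist 𝒢) ⟶ ⟨X.unop⟩))
      simpa [toSheafTwist, toPresheaf] using this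
    · rfl

theorem isSheaf_incl_comp (F : Sheaf (Twist.topology 𝒢 J) D) :
    Presheaf.IsSheaf J ((Twist.incl 𝒢).op ⋙ F.obj) := by
  intro E X S hS x hx
  have hx' : ∀ {Y₁ Y₂ Z : C} (g₁ : Z ⟶ Y₁) (g₂ : Z ⟶ Y₂) {f₁ : Y₁ ⟶ X} {f₂ : Y₂ ⟶ X}
      (h₁ : S f₁) (h₂ : S f₂), g₁ ≫ f₁ = g₂ ≫ f₂ →
      (x f₁ h₁ : E ⟶ F.obj.obj (op ⟨Y₁⟩)) ≫ F.obj.map ((Twist.incl 𝒢).map g₁).op =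
      (x f₂ h₂ : E ⟶ F.obj.obj (op ⟨Y₂⟩)) ≫ F.obj.map ((Twist.incl 𝒢).map g₂).op :=
    fun g₁ g₂ _ _ h₁ h₂ h => hx g₁ g₂ h₁ h₂ h
  let S' : Sieve (⟨X⟩ : Twist 𝒢) :=
    { arrows := fun Y f => S f.base
      downward_closed := fun {Y Z f} hf g => S.downward_closed hf g.base }
  have hS' : S' ∈ Twist.topology 𝒢 J ⟨X⟩ := by
    refine J.superset_covering ?_ hS
    intro Y f hf
    exact hf
  let x' : Presieve.FamilyOfElements (F.obj ⋙ coyoneda.obj (op E)) S'.arrows := fun Y f hf =>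
    (x f.base hf : E ⟶ F.obj.obj (op Y)) ≫
      F.obj.map (Quiver.Hom.op (Twist.homMk (𝟙 _) (f.tw) : Y ⟶ Y))
  have tr : ∀ {Y Z : Twist 𝒢} (g : Z ⟶ Y) (f : Y ⟶ ⟨X⟩) (hf : S f.base),
      ((x f.base hf : E ⟶ F.obj.obj (op Y)) ≫
        F.obj.map (Quiver.Hom.op (Twist.homMk (𝟙 _) (f.tw) : Y ⟶ Y))) ≫ F.obj.map g.op =
      ((x f.base hf : E ⟶ F.obj.obj (op Y)) ≫
        F.obj.map (Quiver.Hom.op (Twist.homMk (g.base) (1) : Z ⟶ Y))) ≫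
        F.obj.map (Quiver.Hom.op (Twist.homMk (𝟙 _) ((g ≫ f).tw) : Z ⟶ Z)) := by
    intro Y Z g f hf
    have e : g ≫ (Twist.homMk (𝟙 _) f.tw : Y ⟶ Y) =
        (Twist.homMk (𝟙 _) (g ≫ f).tw : Z ⟶ Z) ≫ (Twist.homMk g.base 1 : Z ⟶ Y) := by
      ext <;> simp
    refine (Category.assoc _ _ _).trans (Eq.trans ?_ (Category.assoc _ _ _).symm)
    refine congrArg ((x f.base hf : E ⟶ F.obj.obj (op Y)) ≫ ·) ?_
    refine (F.obj.map_comp _ _).symm.trans (Eq.trans ?_ (F.obj.map_comp _ _))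
    exact congrArg (fun k => F.obj.map (Quiver.Hom.op k)) e
  have hxc : x'.Compatible := by
    intro Y₁ Y₂ Z g₁ g₂ f₁ f₂ h₁ h₂ h
    have e := hx' g₁.base g₂.base h₁ h₂ (congrArg Twist.Hom.base h)
    refine (tr g₁ f₁ h₁).trans (Eq.trans ?_ (tr g₂ f₂ h₂).symm)
    rw [h]
    exact congrArg (· ≫ F.obj.map (Quiver.Hom.op (Twist.homMk (𝟙 _) ((g₂ ≫ f₂).tw) : Z ⟶ Z))) e
  obtain ⟨t, ht, ht'⟩ := F.property E S' hS' x' hxc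
  refine ⟨t, fun Y f hf => ?_, fun t' h' => ht' t' fun Y f hf => ?_⟩
  · refine (ht (Y := ⟨Y⟩) ((Twist.incl 𝒢).map f) hf).trans ?_
    refine Eq.trans ?_ (Category.comp_id (x f hf : E ⟶ F.obj.obj (op ⟨Y⟩)))
    exact congrArg ((x f hf : E ⟶ F.obj.obj (op ⟨Y⟩)) ≫ ·) (F.obj.map_id _)
  · have h1 : (t' : E ⟶ F.obj.obj (op ⟨X⟩)) ≫ F.obj.map ((Twist.incl 𝒢).map f.base).op =
        x f.base hf := h' f.base hf
    have h2 : f = (Twist.homMk (𝟙 _) (f.tw) : Y ⟶ Y) ≫ (Twist.homMk (f.base) (1) : Y ⟶ ⟨X⟩) := by ext <;> simp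
    have h3 : (t' : E ⟶ F.obj.obj (op ⟨X⟩)) ≫ F.obj.map f.op =
        (x f.base hf : E ⟶ F.obj.obj (op Y)) ≫
          F.obj.map (Quiver.Hom.op (Twist.homMk (𝟙 _) (f.tw) : Y ⟶ Y)) := by
      rw [← h1]
      refine Eq.trans ?_ (Category.assoc _ _ _).symm
      refine congrArg ((t' : E ⟶ F.obj.obj (op ⟨X⟩)) ≫ ·) ?_
      refine Eq.trans ?_ (F.obj.map_comp _ _)
      exact congrArg (fun k => F.obj.map (Quiver.Hom.op k)) h2
    exact h3

/-- The equivariant sheaf attached to a sheaf on the twisted site. -/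
def ofSheafTwist (F : Sheaf (Twist.topology 𝒢 J) D) : EquivariantSheaf J 𝒢 D where
  sheaf := ⟨(Twist.incl 𝒢).op ⋙ F.obj, isSheaf_incl_comp F⟩
  act X :=
    { toFun g := F.obj.map (Quiver.Hom.op (Twist.homMk (𝟙 _) (g) : (⟨X.unop⟩ : Twist 𝒢) ⟶ ⟨X.unop⟩))
      map_one' := F.obj.map_id _
      map_mul' g h := by
        refine Eq.trans ?_ (F.obj.map_comp _ _)
        refine congrArg (fun k : (⟨X.unop⟩ : Twist 𝒢) ⟶ ⟨X.unop⟩ => F.obj.map (Quiver.Hom.op k))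
          (a₂ := Twist.homMk (𝟙 _) g ≫ Twist.homMk (𝟙 _) h) ?_
        ext <;> simp }
  act_map {X Y} f g := by
    refine (F.obj.map_comp _ _).symm.trans (Eq.trans ?_ (F.obj.map_comp _ _))
    congr 1
    apply Quiver.Hom.unop_inj
    ext <;> simp [Twist.incl]

instance : (toSheafTwist J 𝒢 D).EssSurj where
  mem_essImage F := by
    refine ⟨ofSheafTwist F, ⟨(fullyFaithfulSheafToPresheaf _ _).preimageIso
      (NatIso.ofComponents (fun X => Iso.refl _) fun {X Y} f => ?_)⟩⟩
    refine (Category.comp_id _).trans (Eq.trans ?_ (Category.id_comp _).symm)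
    refine (F.obj.map_comp _ _).symm.trans ?_
    congr 1
    apply Quiver.Hom.unop_inj
    ext <;> simp [Twist.incl]

instance : (toSheafTwist J 𝒢 D).IsEquivalence where

section Abelian

variable (J 𝒢)

instance : Limits.HasFiniteProducts (EquivariantSheaf J 𝒢 AddCommGrpCat.{max u v}) where
  out _ := Adjunction.hasLimitsOfShape_of_equivalence (toSheafTwist J 𝒢 _)

noncomputable instance : Abelian (EquivariantSheaf J 𝒢 AddCommGrpCat.{max u v}) :=
  abelianOfEquivalence (toSheafTwist J 𝒢 _)

instance : EnoughInjectives (EquivariantSheaf J 𝒢 AddCommGrpCat.{max u v}) := by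
  have := enoughInjectives_sheaf (Twist.topology 𝒢 J)
  exact .of_equivalence (toSheafTwist J 𝒢 AddCommGrpCat.{max u v})

end Abelian

section GlobalSections

/-- The action of a section of `𝒢` as a homomorphism. -/
abbrev actHom (A : EquivariantSheaf J 𝒢 AddCommGrpCat.{max u v}) {X : Cᵒᵖ} (g : 𝒢.obj X) :
    A.sheaf.obj.obj X ⟶ A.sheaf.obj.obj X := A.act X g

/-- The group `Γ(A) = Hom_{B𝒢}(*, A)`. A morphism from the terminal object of `B𝒢` to `A` is a
compatible family of sections `s_X ∈ A(X)` such that each `s_X` is fixed by `𝒢(X)`. -/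
def invariants (A : EquivariantSheaf J 𝒢 AddCommGrpCat.{max u v}) :
    AddSubgroup (∀ X : C, A.sheaf.obj.obj (op X)) where
  carrier := { s | (∀ ⦃X Y : C⦄ (f : X ⟶ Y), A.sheaf.obj.map f.op (s Y) = s X) ∧
    ∀ (X : C) (g : 𝒢.obj (op X)),
      A.actHom g (s X) = s X }
  zero_mem' := by simp
  add_mem' {s t} hs ht := by
    refine ⟨fun X Y f => ?_, fun X g => ?_⟩
    · rw [Pi.add_apply, map_add, hs.1 f, ht.1 f, Pi.add_apply]
    · rw [Pi.add_apply, map_add, hs.2 X g, ht.2 X g]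
  neg_mem' {s} hs := by
    refine ⟨fun X Y f => ?_, fun X g => ?_⟩
    · rw [Pi.neg_apply, map_neg, hs.1 f, Pi.neg_apply]
    · rw [Pi.neg_apply, map_neg, hs.2 X g]

variable (J 𝒢) in
/-- The global section functor `Γ` on abelian group objects of `B𝒢`. -/
def globalSections : EquivariantSheaf J 𝒢 AddCommGrpCat.{max u v} ⥤ AddCommGrpCat.{max u v} where
  obj A := AddCommGrpCat.of A.invariants
  map {A B} f := AddCommGrpCat.ofHom
    { toFun s := ⟨fun X => f.hom.hom.app (op X) (s.1 X), by
        refine ⟨fun X Y h => ?_, fun X g => ?_⟩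
        · refine Eq.trans ?_ (congrArg (f.hom.hom.app (op X)) (s.2.1 h))
          exact (ConcreteCategory.congr_hom (f.hom.hom.naturality h.op) (s.1 Y)).symm
        · refine Eq.trans ?_ (congrArg (f.hom.hom.app (op X)) (s.2.2 X g))
          exact (ConcreteCategory.congr_hom (f.comm (op X) g) (s.1 X)).symm⟩
      map_zero' := by ext X; simp
      map_add' s t := by ext X; simp }

instance : (globalSections J 𝒢).Additive where
  map_add {A B f g} := by
    ext s
    rfl

/-- `Hⁱ(𝒢, A) = (RⁱΓ)(A)`, as a functor of `A`. -/
noncomputable def cohomology (J : GrothendieckTopology C) (𝒢 : Cᵒᵖ ⥤ GrpCat.{v}) (i : ℕ) :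
    EquivariantSheaf J 𝒢 AddCommGrpCat.{max u v} ⥤ AddCommGrpCat.{max u v} :=
  (globalSections J 𝒢).rightDerived i

end GlobalSections

end EquivariantSheaf
end EquivariantSheaves

end LocAnCoh

open scoped Manifold ContDiff

namespace LocAnCoh

section Analytic

variable (K : Type u) [NontriviallyNormedField K]

/-- A BH-space for `V`: a (nonarchimedean) Banach space over `K` with a continuous linear
injection into `V`. -/
structure BHSpace (V : Type u) [AddCommGroup V] [Module K V] [TopologicalSpace V] where
  carrier : Type u
  [normedAddCommGroup : NormedAddCommGroup carrier]
  [normedSpace : NormedSpace K carrier]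
  [completeSpace : CompleteSpace carrier]
  [isUltrametricDist : IsUltrametricDist carrier]
  incl : carrier →L[K] V
  injective : Function.Injective incl

attribute [instance] BHSpace.normedAddCommGroup BHSpace.normedSpace BHSpace.completeSpace
  BHSpace.isUltrametricDist

variable {K} {V : Type u} [AddCommGroup V] [Module K V] [TopologicalSpace V]
variable {E H M : Type*} [NormedAddCommGroup E] [NormedSpace K E] [TopologicalSpace H]
  [TopologicalSpace M] [ChartedSpace H M]
variable {E' H' M' : Type*} [NormedAddCommGroup E'] [NormedSpace K E'] [TopologicalSpace H']
  [TopologicalSpace M'] [ChartedSpace H' M']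

/-- A function `f : M → V` on a manifold is analytic at `x` if there are an open neighbourhood `U`
of `x` and a BH-space `W` of `V` such that `f` restricted to `U` factors through an analytic map
from `U` to `W`. -/
def IsAnalyticAt (I : ModelWithCorners K E H) (f : M → V) (x : M) : Prop :=
  ∃ U : Set M, IsOpen U ∧ x ∈ U ∧ ∃ (W : BHSpace K V) (f' : M → W.carrier),
    ContMDiffOn I 𝓘(K, W.carrier) ω f' U ∧ ∀ y ∈ U, f y = W.incl (f' y)

/-- The (locally) analytic functions `f : M → V`. -/
def IsAnalytic (I : ModelWithCorners K E H) (f : M → V) : Prop :=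
  ∀ x : M, IsAnalyticAt I f x

namespace IsAnalytic

variable {I : ModelWithCorners K E H} {I' : ModelWithCorners K E' H'}

theorem analyticAt_of_eqOn {f : M → V} (hf : IsAnalytic I f) {φ : M' → M} {s : Set M'}
    (hs : IsOpen s) (hφ : ContMDiffOn I' I ω φ s) {h : M' → V} (he : ∀ y ∈ s, h y = f (φ y))
    {x : M'} (hx : x ∈ s) : IsAnalyticAt I' h x := by
  obtain ⟨U, hU, hxU, W, f', hf', h⟩ := hf (φ x)
  exact ⟨s ∩ φ ⁻¹' U, hφ.continuousOn.isOpen_inter_preimage hs hU, ⟨hx, hxU⟩, W, f' ∘ φ,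
    hf'.comp (hφ.mono Set.inter_subset_left) (fun _ h => h.2),
    fun y hy => (he y hy.1).trans (h _ hy.2)⟩

theorem comp {f : M → V} (hf : IsAnalytic I f) {φ : M' → M} (hφ : ContMDiff I' I ω φ) :
    IsAnalytic I' (fun x => f (φ x)) := fun x =>
  hf.analyticAt_of_eqOn isOpen_univ hφ.contMDiffOn (fun _ _ => rfl) (Set.mem_univ x)

theorem zero : IsAnalytic I (fun _ : M => (0 : V)) := fun _ =>
  haveI : IsUltrametricDist PUnit.{u + 1} := ⟨fun _ _ _ => by simp⟩
  ⟨Set.univ, isOpen_univ, trivial,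
    { carrier := PUnit, incl := 0, injective := fun _ _ _ => rfl }, fun _ => 0,
    contMDiffOn_const, fun _ _ => rfl⟩

theorem const_smul {f : M → V} (hf : IsAnalytic I f) (c : K) :
    IsAnalytic I (fun x => c • f x) := by
  intro x
  obtain ⟨U, hU, hx, W, f', hf', h⟩ := hf x
  refine ⟨U, hU, hx, W, fun y => c • f' y, ?_, fun y hy => by simp [h y hy]⟩
  exact (c • ContinuousLinearMap.id K W.carrier).contMDiff.comp_contMDiffOn hf'

end IsAnalytic

theorem isUltrametricDist_prod (W₁ W₂ : Type*) [NormedAddCommGroup W₁] [NormedAddCommGroup W₂]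
    [IsUltrametricDist W₁] [IsUltrametricDist W₂] : IsUltrametricDist (W₁ × W₂) := by
  refine ⟨fun x y z => ?_⟩
  simp only [Prod.dist_eq]
  have h1 := dist_triangle_max x.1 y.1 z.1
  have h2 := dist_triangle_max x.2 y.2 z.2
  refine max_le (h1.trans ?_) (h2.trans ?_)
  · exact max_le_max (le_max_left _ _) (le_max_left _ _)
  · exact max_le_max (le_max_right _ _) (le_max_right _ _)

theorem isUltrametricDist_quotient {W : Type*} [NormedAddCommGroup W] [NormedSpace K W]
    [IsUltrametricDist W] (N : Submodule K W) : IsUltrametricDist (W ⧸ N) := by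
  apply IsUltrametricDist.isUltrametricDist_of_forall_norm_add_le_max_norm
  intro x y
  refine le_of_forall_pos_le_add fun ε hε => ?_
  obtain ⟨a, rfl, ha⟩ := Submodule.Quotient.norm_mk_lt x hε
  obtain ⟨b, rfl, hb⟩ := Submodule.Quotient.norm_mk_lt y hε
  calc _ ≤ ‖a + b‖ := Submodule.Quotient.norm_mk_le _ (a + b)
    _ ≤ max ‖a‖ ‖b‖ := IsUltrametricDist.norm_add_le_max a b
    _ ≤ max _ _ := max_le_max ha.le hb.le
    _ = _ := max_add_add_right _ _ _

/-- The sum of two BH-spaces is a BH-space. -/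
theorem BHSpace.exists_sum [IsTopologicalAddGroup V] [T2Space V] (W₁ W₂ : BHSpace K V) :
    ∃ (W : BHSpace K V) (q : W₁.carrier × W₂.carrier →L[K] W.carrier),
      ∀ x, W.incl (q x) = W₁.incl x.1 + W₂.incl x.2 := by
  let s : W₁.carrier × W₂.carrier →L[K] V := W₁.incl.coprod W₂.incl
  have : IsClosed (s.ker : Set (W₁.carrier × W₂.carrier)) := s.isClosed_ker
  have := isUltrametricDist_prod W₁.carrier W₂.carrier
  have := isUltrametricDist_quotient (K := K) s.ker
  refine ⟨{ carrier := (W₁.carrier × W₂.carrier) ⧸ s.ker, incl := s.ker.liftQL s le_rfl,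
            injective := ?_ }, s.ker.mkQL, fun x => ?_⟩
  · have := Submodule.ker_liftQ_eq_bot s.ker s.toLinearMap le_rfl le_rfl
    exact LinearMap.ker_eq_bot.1 this
  · rfl

theorem IsAnalytic.add [IsTopologicalAddGroup V] [T2Space V] {I : ModelWithCorners K E H}
    {f g : M → V} (hf : IsAnalytic I f) (hg : IsAnalytic I g) :
    IsAnalytic I (fun x => f x + g x) := by
  intro x
  obtain ⟨U₁, hU₁, hx₁, W₁, f', hf', h₁⟩ := hf x
  obtain ⟨U₂, hU₂, hx₂, W₂, g', hg', h₂⟩ := hg x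
  obtain ⟨W, q, hq⟩ := BHSpace.exists_sum W₁ W₂
  refine ⟨U₁ ∩ U₂, hU₁.inter hU₂, ⟨hx₁, hx₂⟩, W, fun y => q (f' y, g' y), ?_, fun y hy => ?_⟩
  · exact q.contMDiff.comp_contMDiffOn
      ((hf'.mono Set.inter_subset_left).prodMk_space (hg'.mono Set.inter_subset_right))
  · simp [hq, h₁ y hy.1, h₂ y hy.2]

end Analytic

section La

variable (K : Type u) [NontriviallyNormedField K]

/-- The category of manifolds: paracompact Hausdorff locally `K`-analytic manifolds modelled on a
finite dimensional `K`-vector space, and locally analytic maps. -/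
structure La where
  carrier : Type u
  model : Type u
  [normedAddCommGroup : NormedAddCommGroup model]
  [normedSpace : NormedSpace K model]
  [finiteDimensional : FiniteDimensional K model]
  [topologicalSpace : TopologicalSpace carrier]
  [t2Space : T2Space carrier]
  [paracompactSpace : ParacompactSpace carrier]
  [chartedSpace : ChartedSpace model carrier]
  [isManifold : IsManifold 𝓘(K, model) ω carrier]

namespace La

attribute [instance] normedAddCommGroup normedSpace finiteDimensional topologicalSpace t2Space
  paracompactSpace chartedSpace isManifold

variable {K}

/-- The model with corners of a manifold (there is no boundary). -/
abbrev I (X : La K) : ModelWithCorners K X.model X.model := 𝓘(K, X.model)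

instance : Category (La K) where
  Hom X Y := C^ω⟮X.I, X.carrier; Y.I, Y.carrier⟯
  id X := ContMDiffMap.id
  comp f g := ContMDiffMap.comp g f

/-- The underlying map of a morphism. -/
def fn {X Y : La K} (f : X ⟶ Y) : C^ω⟮X.I, X.carrier; Y.I, Y.carrier⟯ := f

@[simp] theorem fn_id (X : La K) (x : X.carrier) : fn (𝟙 X) x = x := rfl

@[simp] theorem fn_comp {X Y Z : La K} (f : X ⟶ Y) (g : Y ⟶ Z) (x : X.carrier) :
    fn (f ≫ g) x = fn g (fn f x) := rfl

/-- A paracompact open subset as an open submanifold. -/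
noncomputable def openSub (X : La K) (U : TopologicalSpace.Opens X.carrier) [ParacompactSpace U] : La K where
  carrier := U
  model := X.model

/-- The underlying map of the inclusion of an open submanifold. -/
def openVal (X : La K) (U : TopologicalSpace.Opens X.carrier) [ParacompactSpace U] :
    (X.openSub U).carrier → X.carrier := fun x : U => x.1

theorem contMDiff_openVal (X : La K) (U : TopologicalSpace.Opens X.carrier) [ParacompactSpace U] :
    ContMDiff (X.openSub U).I X.I ω (X.openVal U) :=
  contMDiff_subtype_val (I := X.I) (U := U)

/-- The inclusion of an open submanifold. -/
noncomputable def openIncl (X : La K) (U : TopologicalSpace.Opens X.carrier) [ParacompactSpace U] :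
    X.openSub U ⟶ X :=
  ⟨X.openVal U, X.contMDiff_openVal U⟩

/-- Analytic maps into an open submanifold. -/
theorem contMDiffOn_toOpen {E H M : Type*} [NormedAddCommGroup E] [NormedSpace K E]
    [TopologicalSpace H] [TopologicalSpace M] [ChartedSpace H M] {I : ModelWithCorners K E H}
    {X : La K} {U : TopologicalSpace.Opens X.carrier} [ParacompactSpace U]
    {f : M → (X.openSub U).carrier} {s : Set M}
    (h : ContMDiffOn I X.I ω (fun x => X.openVal U (f x)) s) :
    ContMDiffOn I (X.openSub U).I ω f s := fun x hx =>
  (ChartedSpace.liftPropWithinAt_subtypeVal_comp_iff (U := U) (H' := X.model) f s x).1 (h x hx)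

/-- A map between manifolds with values in an open subset, as a map to the open submanifold. -/
noncomputable def toOpen {X Y : La K} {U : TopologicalSpace.Opens X.carrier} [ParacompactSpace U]
    (f : Y ⟶ X) (h : ∀ y, fn f y ∈ U) : Y ⟶ X.openSub U :=
  ⟨fun y => (⟨fn f y, h y⟩ : U), contMDiffOn_univ.1 (contMDiffOn_toOpen (fn f).contMDiff.contMDiffOn)⟩

/-- Every open subset contains a paracompact open neighbourhood of each of its points. -/
theorem exists_paracompact (X : La K) {U : Set X.carrier} (hU : IsOpen U) {x : X.carrier}
    (hx : x ∈ U) :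
    ∃ V : TopologicalSpace.Opens X.carrier, x ∈ V ∧ (V : Set X.carrier) ⊆ U ∧
      ParacompactSpace V := by
  let e := chartAt X.model x
  let V : TopologicalSpace.Opens X.carrier := ⟨e.source ∩ U, e.open_source.inter hU⟩
  refine ⟨V, ⟨mem_chart_source _ x, hx⟩, Set.inter_subset_right, ?_⟩
  have hemb : Topology.IsEmbedding (fun y : V => e y.1) := by
    have h1 := e.isOpenEmbedding_restrict.isEmbedding
    exact h1.comp (Topology.IsEmbedding.inclusion (Set.inter_subset_left))
  have : TopologicalSpace.MetrizableSpace V := hemb.metrizableSpace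
  let _ := TopologicalSpace.metrizableSpaceMetric V
  infer_instance

variable (K) in
/-- The topology of open coverings: a sieve on `X` is covering if `X` is covered by open
submanifolds (objects of `La`) whose inclusions belong to the sieve. -/
def topology : GrothendieckTopology (La K) where
  sieves X := { S | ∀ x : X.carrier, ∃ (U : TopologicalSpace.Opens X.carrier)
    (_ : ParacompactSpace U), x ∈ U ∧ S (X.openIncl U) }
  top_mem' X x := by
    obtain ⟨V, hV, -, hp⟩ := X.exists_paracompact isOpen_univ (Set.mem_univ x)
    exact ⟨V, hp, hV, trivial⟩
  pullback_stable' X Y S f hS y := by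
    obtain ⟨U, hU, hx, h⟩ := hS (fn f y)
    obtain ⟨V, hV, hVU, hp⟩ := Y.exists_paracompact
      (U.isOpen.preimage (fn f).contMDiff.continuous) (x := y) hx
    refine ⟨V, hp, hV, ?_⟩
    exact S.downward_closed h (toOpen (Y.openIncl V ≫ f) fun z : V => hVU z.2)
  transitive' X S hS R hR x := by
    obtain ⟨U, hU, hx, h⟩ := hS x
    obtain ⟨V, hV, hxV, h'⟩ := hR h ⟨x, hx⟩
    let U' : TopologicalSpace.Opens X.carrier :=
      ⟨X.openVal U '' V, U.isOpen.isOpenMap_subtype_val _ V.isOpen⟩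
    obtain ⟨V', hV', hVU, hp⟩ := X.exists_paracompact U'.isOpen (x := x) ⟨⟨x, hx⟩, hxV, rfl⟩
    refine ⟨V', hp, hV', ?_⟩
    have key : ∀ z : V', ∃ hz : z.1 ∈ U, (⟨z.1, hz⟩ : U) ∈ V := by
      rintro ⟨z, hz⟩
      obtain ⟨w, hw, rfl⟩ := hVU hz
      exact ⟨w.2, hw⟩
    exact R.downward_closed h' (toOpen (toOpen (X.openIncl V') fun z : V' => (key z).1)
      fun z : V' => (key z).2)

/-- A map from `X` to an open submanifold `U` which is the identity on `U`. -/
theorem exists_retraction (X : La K) (U : TopologicalSpace.Opens X.carrier) [ParacompactSpace U]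
    (x : U) : ∃ r : X.carrier → (X.openSub U).carrier, ContMDiffOn X.I (X.openSub U).I ω r U ∧
      ∀ y : U, r y.1 = y := by
  classical
  refine ⟨fun y => if h : y ∈ U then (⟨y, h⟩ : U) else x, ?_, fun y => (dif_pos y.2 :)⟩
  refine contMDiffOn_toOpen ((contMDiffOn_id (I := X.I)).congr fun y hy => ?_)
  have : y ∈ U := hy
  simp [this, openVal]

end La
end La

section Representation

variable {K : Type u} [NontriviallyNormedField K]
variable {E G : Type u} [NormedAddCommGroup E] [NormedSpace K E]
  [TopologicalSpace G] [ChartedSpace E G] [Group G]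
variable {V : Type u} [AddCommGroup V] [Module K V] [TopologicalSpace V]

variable (E) in
/-- A topological representation of `G` on `V` is locally analytic if all orbit maps are
analytic. -/
def IsLocallyAnalyticRep (ρ : G →* (V ≃L[K] V)) : Prop :=
  ∀ v : V, IsAnalytic 𝓘(K, E) (fun g : G => ρ g v)

variable [IsTopologicalAddGroup V] [T2Space V]

variable (E) in
/-- The admissible functions `X → V`: analytic functions `f` such that `(g, x) ↦ g f(x)` is
analytic on `G × X`. -/
def admissible (ρ : G →* (V ≃L[K] V)) (X : La K) : Submodule K (X.carrier → V) where
  carrier := { f | IsAnalytic X.I f ∧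
    IsAnalytic (𝓘(K, E).prod X.I) (fun p : G × X.carrier => ρ p.1 (f p.2)) }
  zero_mem' := ⟨.zero, by simpa using .zero⟩
  add_mem' {f f'} hf hf' := ⟨hf.1.add hf'.1, by simpa using hf.2.add hf'.2⟩
  smul_mem' c f hf := ⟨hf.1.const_smul c, by simpa using hf.2.const_smul c⟩

/-- Pullback of admissible functions. -/
def admissibleMap (ρ : G →* (V ≃L[K] V)) {X Y : La K} (φ : X ⟶ Y) :
    admissible E ρ Y →ₗ[K] admissible E ρ X where
  toFun f := ⟨fun x => f.1 (La.fn φ x), f.2.1.comp (La.fn φ).contMDiff,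
    f.2.2.comp (contMDiff_id.prodMap (La.fn φ).contMDiff)⟩
  map_add' _ _ := rfl
  map_smul' _ _ := rfl

variable (E) in
/-- The presheaf of admissible functions. -/
def admissiblePresheaf (ρ : G →* (V ≃L[K] V)) : (La K)ᵒᵖ ⥤ AddCommGrpCat.{u + 1} where
  obj X := AddCommGrpCat.of (ULift.{u + 1} (admissible E ρ X.unop))
  map φ := AddCommGrpCat.ofHom
    { toFun f := ⟨admissibleMap ρ φ.unop f.down⟩
      map_zero' := rfl
      map_add' _ _ := rfl }

theorem admissiblePresheaf_isSheaf (ρ : G →* (V ≃L[K] V)) :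
    Presheaf.IsSheaf (La.topology K) (admissiblePresheaf E ρ) := by
  rw [Presheaf.isSheaf_iff_isSheaf_forget _ _ (forget AddCommGrpCat.{u + 1}),
    isSheaf_iff_isSheaf_of_type]
  intro X S hS x hx
  let x' : ∀ {Y : La K} (f : Y ⟶ X), S f → admissible E ρ Y := fun f hf => (x f hf).down
  have hx' : ∀ {Y₁ Y₂ Z : La K} (g₁ : Z ⟶ Y₁) (g₂ : Z ⟶ Y₂) {f₁ : Y₁ ⟶ X} {f₂ : Y₂ ⟶ X}
      (h₁ : S f₁) (h₂ : S f₂), g₁ ≫ f₁ = g₂ ≫ f₂ → ∀ z : Z.carrier,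
      (x' f₁ h₁).1 (La.fn g₁ z) = (x' f₂ h₂).1 (La.fn g₂ z) := by
    intro Y₁ Y₂ Z g₁ g₂ f₁ f₂ h₁ h₂ h z
    exact congrArg (fun t : ULift.{u + 1} (admissible E ρ Z) => t.down.1 z)
      (hx g₁ g₂ h₁ h₂ h)
  choose U hU hxU hSU using hS
  let F : X.carrier → V := fun p => (x' _ (hSU p)).1 (⟨p, hxU p⟩ : U p)
  have hF : ∀ {Y : La K} (f : Y ⟶ X) (hf : S f) (y : Y.carrier), (x' f hf).1 y = F (La.fn f y) := by
    intro Y f hf y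
    obtain ⟨W, hyW, hWU, hW⟩ := Y.exists_paracompact
      ((U (La.fn f y)).isOpen.preimage (La.fn f).contMDiff.continuous) (x := y) (hxU _)
    exact hx' (Y.openIncl W) (La.toOpen (Y.openIncl W ≫ f) fun z : W => hWU z.2) hf (hSU _) rfl
      (⟨y, hyW⟩ : W)
  have hF' : ∀ (p : X.carrier) (q : U p), F q = (x' _ (hSU p)).1 q := fun p q =>
    (hF _ (hSU p) q).symm
  have hFa : F ∈ admissible E ρ X := by
    refine ⟨fun p => ?_, fun p => ?_⟩
    · obtain ⟨r, hr, hr'⟩ := X.exists_retraction (U p) ⟨p, hxU p⟩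
      refine (x' _ (hSU p)).2.1.analyticAt_of_eqOn (U p).isOpen hr (fun y hy => ?_) (hxU p)
      rw [hr' ⟨y, hy⟩]
      exact hF' p ⟨y, hy⟩
    · obtain ⟨r, hr, hr'⟩ := X.exists_retraction (U p.2) ⟨p.2, hxU p.2⟩
      refine (x' _ (hSU p.2)).2.2.analyticAt_of_eqOn (φ := Prod.map id r)
        (s := Set.univ ×ˢ (U p.2 : Set X.carrier)) (isOpen_univ.prod (U p.2).isOpen)
        (contMDiffOn_id.prodMap hr) (fun y hy => ?_) ⟨trivial, hxU p.2⟩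
      have : r y.2 = (⟨y.2, hy.2⟩ : U p.2) := hr' ⟨y.2, hy.2⟩
      simp only [Prod.map, id, this]
      exact congrArg (ρ y.1) (hF' p.2 ⟨y.2, hy.2⟩)
  refine ⟨⟨⟨F, hFa⟩⟩, fun Y f hf => ?_, fun t ht => ?_⟩
  · apply ULift.down_injective
    apply Subtype.ext
    funext y
    exact (hF f hf y).symm
  · apply ULift.down_injective
    apply Subtype.ext
    funext p
    exact congrArg (fun t : ULift.{u + 1} (admissible E ρ (X.openSub (U p))) =>
      t.down.1 (⟨p, hxU p⟩ : U p)) (ht _ (hSU p))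

variable [LieGroup 𝓘(K, E) ω G]

variable (K E G) in
/-- The sheaf of groups `y(G)` on `La` represented by `G`. -/
def yG : (La K)ᵒᵖ ⥤ GrpCat.{u} where
  obj X := GrpCat.of C^ω⟮X.unop.I, X.unop.carrier; 𝓘(K, E), G⟯
  map φ := GrpCat.ofHom
    { toFun g := g.comp (La.fn φ.unop)
      map_one' := rfl
      map_mul' _ _ := rfl }

/-- The action of an analytic map `g : X → G` on admissible functions, `(g f)(x) = g(x) f(x)`. -/
def admissibleAct (ρ : G →* (V ≃L[K] V)) (X : La K) (g : C^ω⟮X.I, X.carrier; 𝓘(K, E), G⟯) :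
    admissible E ρ X →ₗ[K] admissible E ρ X where
  toFun f := ⟨fun x => ρ (g x) (f.1 x), f.2.2.comp (g.contMDiff.prodMk contMDiff_id), by
    have h : ContMDiff (𝓘(K, E).prod X.I) (𝓘(K, E).prod X.I) ω
        (fun p : G × X.carrier => (p.1 * g p.2, p.2)) :=
      (contMDiff_fst.mul (g.contMDiff.comp contMDiff_snd)).prodMk contMDiff_snd
    refine cast (congrArg _ (funext fun p => ?_)) (f.2.2.comp h)
    rw [map_mul]
    rfl⟩
  map_add' f f' := by ext x; simp
  map_smul' c f := by ext x; simp

variable (E) in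
/-- The sheaf `V̲` of admissible `V`-valued functions with its action of `y(G)`, an abelian group
object of `BG`. -/
def admissibleSheaf (ρ : G →* (V ≃L[K] V)) :
    EquivariantSheaf (La.topology K) (yG K E G) AddCommGrpCat.{u + 1} where
  sheaf := ⟨admissiblePresheaf E ρ, admissiblePresheaf_isSheaf ρ⟩
  act X :=
    { toFun g := AddCommGrpCat.ofHom
        { toFun := fun f : ULift.{u + 1} (admissible E ρ X.unop) =>
            ULift.up (admissibleAct ρ X.unop g f.down)
          map_zero' := congrArg ULift.up (map_zero (admissibleAct ρ X.unop g))
          map_add' f f' := congrArg ULift.up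
            (map_add (admissibleAct ρ X.unop g) f.down f'.down) }
      map_one' := by
        refine AddCommGrpCat.hom_ext (AddMonoidHom.ext fun f => ?_)
        apply ULift.down_injective
        apply Subtype.ext
        funext x
        exact DFunLike.congr_fun (map_one ρ) _
      map_mul' g h := by
        refine AddCommGrpCat.hom_ext (AddMonoidHom.ext fun f => ?_)
        apply ULift.down_injective
        apply Subtype.ext
        funext x
        exact DFunLike.congr_fun (map_mul ρ _ _) _ }
  act_map f g := rfl

variable (E) in
/-- Multiplication by a scalar `c : K` on `V̲`, as an endomorphism in the category of abelian group
objects of `BG`. -/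
def admissibleSheafSMul (ρ : G →* (V ≃L[K] V)) (c : K) :
    admissibleSheaf E ρ ⟶ admissibleSheaf E ρ where
  hom := ⟨{
    app X := AddCommGrpCat.ofHom
      { toFun := fun f : ULift.{u + 1} (admissible E ρ X.unop) => ULift.up (c • f.down)
        map_zero' := congrArg ULift.up (smul_zero c)
        map_add' f f' := congrArg ULift.up (smul_add c f.down f'.down) }
    naturality X Y f := rfl }⟩
  comm X g := by
    ext f
    apply ULift.down_injective
    exact (map_smul (admissibleAct ρ X.unop g) c f.down).symm

variable (E) in
/-- The locally analytic group cohomology `Hⁱ_an(G, V) = Hⁱ(G, V̲)`. -/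
noncomputable def Han (ρ : G →* (V ≃L[K] V)) (i : ℕ) : AddCommGrpCat.{u + 1} :=
  (EquivariantSheaf.cohomology (La.topology K) (yG K E G) i).obj (admissibleSheaf E ρ)

variable (E) in
/-- The action of a scalar on `Hⁱ_an(G, V)`, by functoriality. -/
noncomputable def HanSMul (ρ : G →* (V ≃L[K] V)) (i : ℕ) (c : K) :
    Han E ρ i ⟶ Han E ρ i :=
  (EquivariantSheaf.cohomology (La.topology K) (yG K E G) i).map (admissibleSheafSMul E ρ c)

end Representation

section Cochains

/-- A map into a finite product of manifolds is analytic if its components are. -/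
theorem contMDiff_pi_manifold {K : Type*} [NontriviallyNormedField K] {ι : Type*} [Fintype ι]
    {E H M : Type*} [NormedAddCommGroup E] [NormedSpace K E] [TopologicalSpace H]
    [TopologicalSpace M] [ChartedSpace H M]
    {E' H' M' : ι → Type*} [∀ i, NormedAddCommGroup (E' i)] [∀ i, NormedSpace K (E' i)]
    [∀ i, TopologicalSpace (H' i)] [∀ i, TopologicalSpace (M' i)]
    [∀ i, ChartedSpace (H' i) (M' i)] {I : ModelWithCorners K E H}
    {I' : ∀ i, ModelWithCorners K (E' i) (H' i)} {f : M → ∀ i, M' i} :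
    ContMDiff I (ModelWithCorners.pi I') ω f ↔ ∀ i, ContMDiff I (I' i) ω (fun x => f x i) := by
  have key : ∀ x, ContMDiffAt I (ModelWithCorners.pi I') ω f x ↔
      ∀ i, ContMDiffAt I (I' i) ω (fun x => f x i) x := by
    intro x
    simp only [contMDiffAt_iff, continuousAt_pi, forall_and]
    exact and_congr_right fun _ => contDiffWithinAt_pi
  exact ⟨fun h i x => (key x).1 (h x) i, fun h x => (key x).2 fun i => h i x⟩

variable {K : Type u} [NontriviallyNormedField K]
variable {E G : Type u} [NormedAddCommGroup E] [NormedSpace K E]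
  [TopologicalSpace G] [ChartedSpace E G] [Group G]
variable {V : Type u} [AddCommGroup V] [Module K V] [TopologicalSpace V]
  [IsTopologicalAddGroup V] [T2Space V]

variable (E) in
/-- Equivariant analytic functions `G^{ι} → V`; for `ι = {0, …, p}` these are the homogeneous
analytic `p`-cochains. -/
def cochains (ρ : G →* (V ≃L[K] V)) (ι : Type) [Fintype ι] : Submodule K ((ι → G) → V) where
  carrier := { f | IsAnalytic (ModelWithCorners.pi fun _ : ι => 𝓘(K, E)) f ∧
    ∀ (g : G) (x : ι → G), f (fun i => g * x i) = ρ g (f x) }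
  zero_mem' := ⟨.zero, by simp⟩
  add_mem' {f f'} hf hf' := ⟨hf.1.add hf'.1, fun g x => by simp [hf.2, hf'.2]⟩
  smul_mem' c f hf := ⟨hf.1.const_smul c, fun g x => by simp [hf.2]⟩

/-- The map on cochains induced by `φ : ι → κ`, i.e. by the map `G^κ → G^ι, x ↦ x ∘ φ`. -/
def cochainsMap (ρ : G →* (V ≃L[K] V)) {ι κ : Type} [Fintype ι] [Fintype κ] (φ : ι → κ) :
    cochains E ρ ι →ₗ[K] cochains E ρ κ where
  toFun f := ⟨fun x => f.1 (fun i => x (φ i)),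
    f.2.1.comp (contMDiff_pi_manifold.2 fun i => contMDiff_pi_manifold.1 contMDiff_id (φ i)),
    fun g x => f.2.2 g fun i => x (φ i)⟩
  map_add' _ _ := rfl
  map_smul' _ _ := rfl

variable (E) in
/-- The cosimplicial `K`-vector space `C^an_G(E_•G, V)`. -/
def cosimplicialCochains (ρ : G →* (V ≃L[K] V)) : CosimplicialObject (ModuleCat.{u} K) where
  obj p := ModuleCat.of K (cochains E ρ (Fin (p.len + 1)))
  map φ := ModuleCat.ofHom (cochainsMap ρ φ.toOrderHom)

variable (E) in
/-- The complex of homogeneous analytic cochains: the differential is the alternating sum of the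
coface maps. -/
noncomputable def cochainComplex (ρ : G →* (V ≃L[K] V)) : CochainComplex (ModuleCat.{u} K) ℕ :=
  (AlgebraicTopology.alternatingCofaceMapComplex _).obj (cosimplicialCochains E ρ)

end Cochains

end LocAnCoh

/-!
Sheaves with an action of a sheaf of groups `𝒢` are sheaves on the twisted site, whose morphisms
`X → Y` are pairs of a morphism `X → Y` of the original site and a section of `𝒢` over `X`; there
`𝒢ⁿ⁺¹` with the diagonal action is a presheaf of sets, and homogeneous cochains with values in `A`
are the morphisms to `A` from the simplicial presheaf of free abelian groups on the `𝒢ⁿ⁺¹`. This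
simplicial presheaf is contractible on sections, so homogeneous cochains are exact in positive
degrees if `A` is injective, and their degree-zero cohomology is `Γ(A)`.

The complex of homogeneous cochains is an exact functor of `A` for `𝒢 = y(G)`: if `G^ι` represents
`𝒢^ι`, then `𝒢^ι` is a retract of a representable presheaf on the twisted site, so `n`-cochains lift
along epimorphisms which are surjective on sections over `Gⁿ⁺¹`. Every epimorphism is surjective on
sections over every manifold, because every open covering of a manifold over an ultrametric field
has a refinement by a partition into open subsets. Hence, by dimension shifting along injective
resolutions, homogeneous cochains compute `RⁱΓ`. With values in `V̲` they are the equivariant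
analytic functions: such a cochain is determined by its value on the identity of `Gⁿ⁺¹`.
-/

universe w

namespace LocAnCoh

section RightDerived

open Limits HomologicalComplex

variable {𝒜 ℬ : Type*} [Category* 𝒜] [Abelian 𝒜] [Category* ℬ] [Abelian ℬ]

@[simp]
theorem iCycles_comp_toCycles (K : CochainComplex 𝒜 ℕ) (i j : ℕ) :
    K.iCycles i ≫ K.toCycles i j = 0 := by
  simp [← cancel_mono (K.iCycles j)]

theorem toCycles_naturality {K L : CochainComplex 𝒜 ℕ} (φ : K ⟶ L) (i j : ℕ) :
    φ.f i ≫ L.toCycles i j = K.toCycles i j ≫ cyclesMap φ j := by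
  simp [← cancel_mono (L.iCycles j)]

/-- The sequence `Zᵏ(K) → Kᵏ → Zᵏ⁺¹(K)` of a cochain complex `K`. -/
noncomputable abbrev cyclesSequence (K : CochainComplex 𝒜 ℕ) (k : ℕ) : ShortComplex 𝒜 :=
  .mk (K.iCycles k) (K.toCycles k (k + 1)) (iCycles_comp_toCycles K k (k + 1))

/-- The morphism of sequences of cycles induced by a morphism of complexes. -/
noncomputable abbrev cyclesSequenceMap {K L : CochainComplex 𝒜 ℕ} (φ : K ⟶ L) (k : ℕ) :
    cyclesSequence K k ⟶ cyclesSequence L k :=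
  ShortComplex.homMk (cyclesMap φ k) (φ.f k) (cyclesMap φ (k + 1)) (by simp)
    (toCycles_naturality φ k (k + 1))

theorem shortExact_cyclesSequence {K : CochainComplex 𝒜 ℕ} {k : ℕ} (h : K.ExactAt (k + 1)) :
    (cyclesSequence K k).ShortExact where
  exact := by
    refine ShortComplex.exact_of_f_is_kernel _ (KernelFork.IsLimit.ofι' _ _ fun g hg => ?_)
    refine ⟨K.liftCycles g (k + 1) (by simp) ?_, K.liftCycles_i _ _ _ _⟩
    rw [← K.toCycles_i k (k + 1), reassoc_of% hg, zero_comp]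
  mono_f := inferInstanceAs (Mono (K.iCycles k))
  epi_g := Preadditive.epi_of_isZero_cokernel' _ (K.homologyIsCokernel k (k + 1) (by simp))
    ((exactAt_iff_isZero_homology _ _).1 h)

theorem mono_homologyMap_zero {K L : CochainComplex 𝒜 ℕ} (φ : K ⟶ L) [Mono φ] :
    Mono (homologyMap φ 0) := by
  have := K.isIso_homologyπ 0 0 (by simp) (by simp)
  have := L.isIso_homologyπ 0 0 (by simp) (by simp)
  rw [show homologyMap φ 0 = inv (K.homologyπ 0) ≫ cyclesMap φ 0 ≫ L.homologyπ 0 by simp]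
  infer_instance

instance : PreservesFiniteLimits (homologyFunctor 𝒜 (ComplexShape.up ℕ) 0) := by
  refine ((homologyFunctor 𝒜 (.up ℕ) 0).preservesFiniteLimits_tfae.out 0 3).1 fun S hS => ?_
  have := hS.mono_f
  exact ⟨hS.homology_exact₂ 0, mono_homologyMap_zero S.f⟩

/-- A description of the `n + 1`st cohomology of `F(K)`, for `F` left exact, as the cokernel of
`F(Kⁿ) → F(Zⁿ⁺¹(K))`. -/
noncomputable def mapLeftHomologyData (F : 𝒜 ⥤ ℬ) [F.Additive] [PreservesFiniteLimits F]
    (K : CochainComplex 𝒜 ℕ) (n : ℕ) {H : ℬ} (π : F.obj (K.cycles (n + 1)) ⟶ H)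
    (wπ : F.map (K.toCycles n (n + 1)) ≫ π = 0) (hπ : (ShortComplex.mk _ π wπ).Exact)
    (epi_π : Epi π) :
    (((F.mapHomologicalComplex (.up ℕ)).obj K).sc' n (n + 1) (n + 2)).LeftHomologyData :=
  have wi : F.map (K.iCycles (n + 1)) ≫ F.map (K.d (n + 1) (n + 2)) = 0 := by
    rw [← F.map_comp, iCycles_d, F.map_zero]
  have wf : F.map (K.d n (n + 1)) ≫ F.map (K.d (n + 1) (n + 2)) = 0 := by
    rw [← F.map_comp, d_comp_d, F.map_zero]
  let hi : IsLimit (KernelFork.ofι (F.map (K.iCycles (n + 1))) wi) :=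
    KernelFork.mapIsLimit _ (K.cyclesIsKernel (n + 1) (n + 2) (by simp)) F
  have lift_eq : hi.lift (KernelFork.ofι _ wf) = F.map (K.toCycles n (n + 1)) :=
    Fork.IsLimit.hom_ext hi ((Fork.IsLimit.lift_ι hi).trans (by simp [← F.map_comp]))
  have exact_of_eq : ∀ f', f' = F.map (K.toCycles n (n + 1)) →
      ∃ w : f' ≫ π = 0, (ShortComplex.mk f' π w).Exact := by
    rintro _ rfl
    exact ⟨wπ, hπ⟩
  { K := F.obj (K.cycles (n + 1))
    H := H
    i := F.map (K.iCycles (n + 1))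
    π := π
    wi := wi
    hi := hi
    wπ := (exact_of_eq _ lift_eq).1
    hπ := (exact_of_eq _ lift_eq).2.gIsCokernel }

theorem f'_comp_of_comp_i {S₁ S₂ : ShortComplex 𝒜} (φ : S₁ ⟶ S₂) (h₁ : S₁.LeftHomologyData)
    (h₂ : S₂.LeftHomologyData) (φK : h₁.K ⟶ h₂.K) (commi : φK ≫ h₂.i = h₁.i ≫ φ.τ₂) :
    h₁.f' ≫ φK = φ.τ₁ ≫ h₂.f' := by
  simp [← cancel_mono h₂.i, commi, φ.comm₁₂]

/-- The functor `Hⁿ ∘ T`. -/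
noncomputable def homologyComp (T : 𝒜 ⥤ CochainComplex ℬ ℕ) (n : ℕ) : 𝒜 ⥤ ℬ :=
  T ⋙ homologyFunctor ℬ (.up ℕ) n

instance (T : 𝒜 ⥤ CochainComplex ℬ ℕ) [T.Additive] (n : ℕ) : (homologyComp T n).Additive :=
  inferInstanceAs (T ⋙ homologyFunctor ℬ (.up ℕ) n).Additive

instance (T : 𝒜 ⥤ CochainComplex ℬ ℕ) [PreservesFiniteLimits T] :
    PreservesFiniteLimits (homologyComp T 0) :=
  comp_preservesFiniteLimits T (homologyFunctor ℬ (.up ℕ) 0)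

section DimensionShift

variable (T : 𝒜 ⥤ CochainComplex ℬ ℕ) [T.Additive] [PreservesFiniteLimits T]
  [PreservesFiniteColimits T] {A B : 𝒜} {I : InjectiveResolution A} {J : InjectiveResolution B}
  (hT : ∀ (I : 𝒜) [Injective I] (n : ℕ), (T.obj I).ExactAt (n + 1))

theorem shortExact_map_cyclesSequence (I : InjectiveResolution A) (k : ℕ) :
    ((cyclesSequence I.cocomplex k).map T).ShortExact :=
  (shortExact_cyclesSequence (I.cocomplex_exactAt_succ k)).map_of_exact T

/-- The connecting homomorphism `Hᵖ(T(Zᵏ⁺¹)) → Hᵖ⁺¹(T(Zᵏ))` of the sequence `Zᵏ → Iᵏ → Zᵏ⁺¹` of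
an injective resolution `I`. -/
noncomputable def connecting (I : InjectiveResolution A) (k p : ℕ) :
    (homologyComp T p).obj (I.cocomplex.cycles (k + 1)) ⟶
      (homologyComp T (p + 1)).obj (I.cocomplex.cycles k) :=
  (shortExact_map_cyclesSequence T I k).δ p (p + 1) rfl

theorem connecting_naturality (φ : I.cocomplex ⟶ J.cocomplex) (k p : ℕ) :
    connecting T I k p ≫ (homologyComp T (p + 1)).map (cyclesMap φ k) =
      (homologyComp T p).map (cyclesMap φ (k + 1)) ≫ connecting T J k p :=
  HomologySequence.δ_naturality (T.mapShortComplex.map (cyclesSequenceMap φ k))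
    (shortExact_map_cyclesSequence T I k) (shortExact_map_cyclesSequence T J k) p (p + 1) rfl

theorem comp_connecting (I : InjectiveResolution A) (k p : ℕ) :
    (homologyComp T p).map (I.cocomplex.toCycles k (k + 1)) ≫ connecting T I k p = 0 :=
  (shortExact_map_cyclesSequence T I k).comp_δ p (p + 1) rfl

theorem exact_connecting (I : InjectiveResolution A) (k p : ℕ) :
    (ShortComplex.mk _ _ (comp_connecting T I k p)).Exact :=
  (shortExact_map_cyclesSequence T I k).homology_exact₃ p (p + 1) rfl

variable {T}

include hT

theorem epi_connecting (I : InjectiveResolution A) (k p : ℕ) : Epi (connecting T I k p) :=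
  (shortExact_map_cyclesSequence T I k).epi_δ p (p + 1) rfl (hT (I.cocomplex.X k) p).isZero_homology

theorem isIso_connecting_succ (I : InjectiveResolution A) (k p : ℕ) :
    IsIso (connecting T I k (p + 1)) :=
  (shortExact_map_cyclesSequence T I k).isIso_δ (p + 1) (p + 2) rfl
    (hT (I.cocomplex.X k) p).isZero_homology (hT (I.cocomplex.X k) (p + 1)).isZero_homology

/-- Dimension shifting `Hᵖ⁺¹(T(Zᵏ)) ≅ Hᵖ⁺ᵏ⁺¹(T(Z⁰))` along an injective resolution. -/
noncomputable def dimensionShift (I : InjectiveResolution A) : ∀ k p q : ℕ, p + k = q →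
    ((homologyComp T (p + 1)).obj (I.cocomplex.cycles k) ≅
      (homologyComp T (q + 1)).obj (I.cocomplex.cycles 0))
  | 0, p, _, h => eqToIso (by rw [← h, add_zero])
  | k + 1, p, q, h =>
    have := isIso_connecting_succ hT I k p
    asIso (connecting T I k (p + 1)) ≪≫ dimensionShift I k (p + 1) q (by lia)

theorem dimensionShift_naturality (φ : I.cocomplex ⟶ J.cocomplex) (k p q : ℕ) (h : p + k = q) :
    (dimensionShift hT I k p q h).hom ≫ (homologyComp T (q + 1)).map (cyclesMap φ 0) =
      (homologyComp T (p + 1)).map (cyclesMap φ k) ≫ (dimensionShift hT J k p q h).hom := by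
  induction k generalizing p with
  | zero =>
    subst h
    exact (Category.id_comp _).trans (Category.comp_id _).symm
  | succ k ih =>
    simp only [dimensionShift, Iso.trans_hom, asIso_hom, Category.assoc, ih,
      reassoc_of% connecting_naturality]

/-- The iterated connecting homomorphism `H⁰(T(Zⁿ⁺¹)) → Hⁿ⁺¹(T(Z⁰))` of an injective
resolution. -/
noncomputable def iteratedConnecting (I : InjectiveResolution A) (n : ℕ) :
    (homologyComp T 0).obj (I.cocomplex.cycles (n + 1)) ⟶
      (homologyComp T (n + 1)).obj (I.cocomplex.cycles 0) :=
  connecting T I n 0 ≫ (dimensionShift hT I n 0 n (zero_add n)).hom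

theorem iteratedConnecting_naturality (φ : I.cocomplex ⟶ J.cocomplex) (n : ℕ) :
    iteratedConnecting hT I n ≫ (homologyComp T (n + 1)).map (cyclesMap φ 0) =
      (homologyComp T 0).map (cyclesMap φ (n + 1)) ≫ iteratedConnecting hT J n := by
  simp only [iteratedConnecting, Category.assoc, dimensionShift_naturality,
    reassoc_of% connecting_naturality]

theorem epi_iteratedConnecting (I : InjectiveResolution A) (n : ℕ) :
    Epi (iteratedConnecting hT I n) :=
  have := epi_connecting hT I n 0
  epi_comp _ _

theorem comp_iteratedConnecting (I : InjectiveResolution A) (n : ℕ) :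
    (homologyComp T 0).map (I.cocomplex.toCycles n (n + 1)) ≫ iteratedConnecting hT I n = 0 := by
  rw [iteratedConnecting, reassoc_of% @comp_connecting, zero_comp]

theorem exact_iteratedConnecting (I : InjectiveResolution A) (n : ℕ) :
    (ShortComplex.mk _ _ (comp_iteratedConnecting hT I n)).Exact := by
  refine ShortComplex.exact_of_iso ?_ (exact_connecting T I n 0)
  exact ShortComplex.isoMk (Iso.refl _) (Iso.refl _) (dimensionShift hT I n 0 n (zero_add n))
    (by simp) (by simp [iteratedConnecting])

/-- A description of the `n + 1`st cohomology of `H⁰(T(I))`, for `I` an injective resolution. -/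
noncomputable def resolutionHomologyData (I : InjectiveResolution A) (n : ℕ) :
    ((((homologyComp T 0).mapHomologicalComplex _).obj I.cocomplex).sc'
      n (n + 1) (n + 2)).LeftHomologyData :=
  mapLeftHomologyData (homologyComp T 0) I.cocomplex n (iteratedConnecting hT I n)
    (comp_iteratedConnecting hT I n) (exact_iteratedConnecting hT I n)
    (epi_iteratedConnecting hT I n)

/-- The morphism of descriptions of cohomology induced by a morphism of injective resolutions. -/
noncomputable def resolutionHomologyMapData (φ : I.cocomplex ⟶ J.cocomplex) (n : ℕ) :
    ShortComplex.LeftHomologyMapData ((shortComplexFunctor' ℬ (.up ℕ) n (n + 1) (n + 2)).map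
      (((homologyComp T 0).mapHomologicalComplex _).map φ))
      (resolutionHomologyData hT I n) (resolutionHomologyData hT J n) :=
  have commi : (homologyComp T 0).map (cyclesMap φ (n + 1)) ≫
      (homologyComp T 0).map (J.cocomplex.iCycles (n + 1)) =
      (homologyComp T 0).map (I.cocomplex.iCycles (n + 1)) ≫
        (homologyComp T 0).map (φ.f (n + 1)) := by
    simp only [← Functor.map_comp, cyclesMap_i]
  { φK := (homologyComp T 0).map (cyclesMap φ (n + 1))
    φH := (homologyComp T (n + 1)).map (cyclesMap φ 0)
    commi := commi
    commf' := f'_comp_of_comp_i _ (resolutionHomologyData hT I n) (resolutionHomologyData hT J n)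
      ((homologyComp T 0).map (cyclesMap φ (n + 1))) commi
    commπ := iteratedConnecting_naturality hT φ n }

/-- The cohomology of `H⁰(T(I))` in degree `n + 1`, for `I` an injective resolution. -/
noncomputable def resolutionHomologyIso (I : InjectiveResolution A) (n : ℕ) :
    ((homologyComp T 0).mapHomologicalComplex (.up ℕ) ⋙
      homologyFunctor ℬ (.up ℕ) (n + 1)).obj I.cocomplex ≅
      (homologyComp T (n + 1)).obj (I.cocomplex.cycles 0) :=
  (homologyFunctorIso' ℬ _ n (n + 1) (n + 2) (by simp) (by simp)).app _ ≪≫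
    (resolutionHomologyData hT I n).homologyIso

theorem resolutionHomologyIso_naturality (φ : I.cocomplex ⟶ J.cocomplex) (n : ℕ) :
    ((homologyComp T 0).mapHomologicalComplex (.up ℕ) ⋙
      homologyFunctor ℬ (.up ℕ) (n + 1)).map φ ≫ (resolutionHomologyIso hT J n).hom =
    (resolutionHomologyIso hT I n).hom ≫ (homologyComp T (n + 1)).map (cyclesMap φ 0) := by
  have h := (homologyFunctorIso' ℬ (.up ℕ) n (n + 1) (n + 2) (by simp) (by simp)).hom.naturality
    (((homologyComp T 0).mapHomologicalComplex _).map φ)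
  refine (Category.assoc _ _ _).symm.trans ((eq_whisker h _).trans ?_)
  refine (Category.assoc _ _ _).trans (Eq.trans ?_ (Category.assoc _ _ _).symm)
  exact whisker_eq _ (resolutionHomologyMapData hT φ n).homologyMap_comm

end DimensionShift

/-- The isomorphism of an object with the zeroth cocycles of an injective resolution. -/
noncomputable def augmentationIso {A : 𝒜} (I : InjectiveResolution A) : A ≅ I.cocomplex.cycles 0 :=
  I.isLimitKernelFork.conePointUniqueUpToIso (I.cocomplex.cyclesIsKernel 0 1 (by simp))

theorem augmentationIso_hom_iCycles {A : 𝒜} (I : InjectiveResolution A) :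
    (augmentationIso I).hom ≫ I.cocomplex.iCycles 0 = I.ι.f 0 :=
  I.isLimitKernelFork.conePointUniqueUpToIso_hom_comp _ WalkingParallelPair.zero

theorem cyclesMap_comp_augmentationIso_inv {A B : 𝒜} {f : A ⟶ B} {I : InjectiveResolution A}
    {J : InjectiveResolution B} {φ : I.cocomplex ⟶ J.cocomplex}
    (h : I.ι.f 0 ≫ φ.f 0 = f ≫ J.ι.f 0) :
    cyclesMap φ 0 ≫ (augmentationIso J).inv = (augmentationIso I).inv ≫ f := by
  rw [Iso.comp_inv_eq, Category.assoc, Iso.eq_inv_comp, ← cancel_mono (J.cocomplex.iCycles 0)]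
  simp only [Category.assoc, cyclesMap_i, augmentationIso_hom_iCycles,
    reassoc_of% augmentationIso_hom_iCycles]
  exact h

section Comparison

variable [HasInjectiveResolutions 𝒜]

/-- The derived functors in positive degrees of `H⁰ ∘ T`, for `T` exact and acyclic on
injectives. -/
noncomputable def rightDerivedSuccIso {T : 𝒜 ⥤ CochainComplex ℬ ℕ} [T.Additive]
    [PreservesFiniteLimits T] [PreservesFiniteColimits T]
    (hT : ∀ (I : 𝒜) [Injective I] (n : ℕ), (T.obj I).ExactAt (n + 1)) (n : ℕ) :
    (homologyComp T 0).rightDerived (n + 1) ≅ homologyComp T (n + 1) :=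
  NatIso.ofComponents
    (fun A => (injectiveResolution A).isoRightDerivedObj _ (n + 1) ≪≫
      resolutionHomologyIso hT _ n ≪≫
      (homologyComp T (n + 1)).mapIso (augmentationIso (injectiveResolution A)).symm)
    fun {A B} f => by
      have hφ := InjectiveResolution.desc_commutes_zero f (injectiveResolution B)
        (injectiveResolution A)
      have h := congrArg (homologyComp T (n + 1)).map (cyclesMap_comp_augmentationIso_inv hφ)
      rw [Functor.map_comp, Functor.map_comp] at h
      simp only [Iso.trans_hom, Functor.mapIso_hom, Iso.symm_hom, Category.assoc]
      rw [InjectiveResolution.isoRightDerivedObj_hom_naturality_assoc f _ _ _ hφ,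
        reassoc_of% resolutionHomologyIso_naturality hT, h]

/-- The derived functors of `H⁰ ∘ T` are the functors `Hⁿ ∘ T`, for `T` exact and acyclic on
injectives. -/
noncomputable def rightDerivedIsoHomology {T : 𝒜 ⥤ CochainComplex ℬ ℕ} [T.Additive]
    [PreservesFiniteLimits T] [PreservesFiniteColimits T]
    (hT : ∀ (I : 𝒜) [Injective I] (n : ℕ), (T.obj I).ExactAt (n + 1)) :
    ∀ n : ℕ, (homologyComp T 0).rightDerived n ≅ homologyComp T n
  | 0 => (homologyComp T 0).rightDerivedZeroIsoSelf
  | n + 1 => rightDerivedSuccIso hT n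

/-- The isomorphism of derived functors induced by an isomorphism of functors. -/
noncomputable def rightDerivedMapIso {F F' : 𝒜 ⥤ ℬ} [F.Additive] [F'.Additive] (e : F ≅ F')
    (n : ℕ) : F.rightDerived n ≅ F'.rightDerived n where
  hom := NatTrans.rightDerived e.hom n
  inv := NatTrans.rightDerived e.inv n
  hom_inv_id := by rw [← NatTrans.rightDerived_comp, e.hom_inv_id, NatTrans.rightDerived_id]
  inv_hom_id := by rw [← NatTrans.rightDerived_comp, e.inv_hom_id, NatTrans.rightDerived_id]

end Comparison

end RightDerived

section HomogeneousCochains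

open Limits HomologicalComplex AlgebraicTopology Simplicial

section Simplicial

variable {𝒜 : Type*} [Category* 𝒜]

theorem exact_of_evaluation {D : Type*} [Category* D] [Abelian 𝒜] (S : ShortComplex (D ⥤ 𝒜))
    (h : ∀ Y, (S.map ((evaluation D 𝒜).obj Y)).Exact) : S.Exact := by
  rw [ShortComplex.exact_iff_isZero_homology]
  exact Functor.isZero _ fun Y => ((ShortComplex.exact_iff_isZero_homology _).1 (h Y)).of_iso
    (S.mapHomologyIso ((evaluation D 𝒜).obj Y)).symm

theorem contraction_comp_d_add_d_comp_contraction [Preadditive 𝒜] (X : SimplicialObject 𝒜)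
    (s : ∀ n, X _⦋n⦌ ⟶ X _⦋n + 1⦌) (h₀ : ∀ n, s n ≫ X.δ 0 = 𝟙 _)
    (h : ∀ n (j : Fin (n + 2)), s (n + 1) ≫ X.δ j.succ = X.δ j ≫ s n) (n : ℕ) :
    s (n + 1) ≫ AlternatingFaceMapComplex.objD X (n + 1) +
      AlternatingFaceMapComplex.objD X n ≫ s n = 𝟙 _ := by
  rw [AlternatingFaceMapComplex.objD, AlternatingFaceMapComplex.objD, Fin.sum_univ_succ,
    Preadditive.comp_add, Preadditive.comp_sum, Preadditive.sum_comp, add_assoc,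
    ← Finset.sum_add_distrib, Finset.sum_eq_zero, add_zero]
  · simp [h₀]
  · intro j _
    simp [h, pow_succ]

theorem exactAt_alternatingFaceMapComplex [Abelian 𝒜] (X : SimplicialObject 𝒜)
    (s : ∀ n, X _⦋n⦌ ⟶ X _⦋n + 1⦌) (h₀ : ∀ n, s n ≫ X.δ 0 = 𝟙 _)
    (h : ∀ n (j : Fin (n + 2)), s (n + 1) ≫ X.δ j.succ = X.δ j ≫ s n) (n : ℕ) :
    ((alternatingFaceMapComplex 𝒜).obj X).ExactAt (n + 1) := by
  rw [exactAt_iff' _ (n + 2) (n + 1) n (by simp) (by simp),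
    ShortComplex.exact_iff_exact_up_to_refinements]
  intro B (z : B ⟶ X _⦋n + 1⦌) hz
  have hz' : z ≫ AlternatingFaceMapComplex.objD X n = 0 := by
    rw [← alternatingFaceMapComplex_obj_d]
    exact hz
  refine ⟨B, 𝟙 B, inferInstance, z ≫ s (n + 1), ?_⟩
  refine (Category.id_comp z).trans (Eq.trans ?_
    (congrArg ((z ≫ s (n + 1)) ≫ ·) (alternatingFaceMapComplex_obj_d X (n + 1)).symm))
  calc z = z ≫ 𝟙 _ := (Category.comp_id z).symm
    _ = (z ≫ s (n + 1)) ≫ AlternatingFaceMapComplex.objD X (n + 1) := by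
      rw [← contraction_comp_d_add_d_comp_contraction X s h₀ h n, Preadditive.comp_add,
        reassoc_of% hz', zero_comp, add_zero, Category.assoc]

theorem alternatingCofaceMapComplex_obj_d [Preadditive 𝒜] (X : CosimplicialObject 𝒜) (n : ℕ) :
    ((alternatingCofaceMapComplex 𝒜).obj X).d n (n + 1) =
      ∑ j : Fin (n + 2), (-1 : ℤ) ^ (j : ℕ) • X.δ j :=
  CochainComplex.of_d (fun n => X.obj ⦋n⦌) (AlternatingCofaceMapComplex.objD X) n

/-- Additive functors commute with alternating coface map complexes. -/
noncomputable def mapAlternatingCofaceMapComplexIso [Preadditive 𝒜] {ℬ : Type*} [Category* ℬ]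
    [Preadditive ℬ] (F : 𝒜 ⥤ ℬ) [F.Additive] (X : CosimplicialObject 𝒜) :
    (F.mapHomologicalComplex _).obj ((alternatingCofaceMapComplex 𝒜).obj X) ≅
      (alternatingCofaceMapComplex ℬ).obj (((CosimplicialObject.whiskering 𝒜 ℬ).obj F).obj X) :=
  Hom.isoOfComponents (fun _ => Iso.refl _) fun i j hij => by
    obtain rfl : i + 1 = j := hij
    refine (Category.id_comp _).trans (Eq.trans ?_ (Category.comp_id _).symm)
    refine (alternatingCofaceMapComplex_obj_d _ i).trans ?_
    refine Eq.trans ?_ (congrArg F.map (alternatingCofaceMapComplex_obj_d X i)).symm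
    refine Eq.trans ?_ (F.map_sum _ _).symm
    exact Finset.sum_congr rfl fun j _ => F.map_zsmul.symm

end Simplicial

section HomComplex

variable {𝒞 : Type*} [Category.{w} 𝒞]

section Preadditive

variable [Preadditive 𝒞]

/-- For a simplicial object `X`, the functor sending `P` to the cochain complex of abelian groups
`n ↦ Hom(Xₙ, P)`. -/
noncomputable def homComplex (X : SimplicialObject 𝒞) : 𝒞 ⥤ CochainComplex AddCommGrpCat.{w} ℕ :=
  (X.rightOp ⋙ preadditiveCoyoneda).flip ⋙ alternatingCofaceMapComplex AddCommGrpCat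

theorem homComplex_d (X : SimplicialObject 𝒞) (P : 𝒞) (n : ℕ) :
    ((homComplex X).obj P).d n (n + 1) =
      (preadditiveYoneda.obj P).map (AlternatingFaceMapComplex.objD X n).op := by
  refine (alternatingCofaceMapComplex_obj_d
    ((X.rightOp ⋙ preadditiveCoyoneda).flip.obj P) n).trans ?_
  rw [AlternatingFaceMapComplex.objD, op_sum, Functor.map_sum]
  exact Finset.sum_congr rfl fun j _ => by rw [op_zsmul, Functor.map_zsmul]; rfl

theorem homComplex_d_apply (X : SimplicialObject 𝒞) (P : 𝒞) (n : ℕ) (φ : X _⦋n⦌ ⟶ P) :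
    ((homComplex X).obj P).d n (n + 1) φ = AlternatingFaceMapComplex.objD X n ≫ φ :=
  ConcreteCategory.congr_hom (homComplex_d X P n) φ

instance (X : SimplicialObject 𝒞) : (homComplex X).Additive where
  map_add {P Q f g} := by
    ext n (φ : X _⦋n⦌ ⟶ P)
    exact Preadditive.comp_add _ _ _ φ f g

instance (X : SimplicialObject 𝒞) : PreservesFiniteLimits (homComplex X) where
  preservesFiniteLimits _ _ _ := preservesLimitsOfShape_of_eval _ fun n =>
    inferInstanceAs (PreservesLimitsOfShape _ (preadditiveCoyoneda.obj (op (X _⦋n⦌))))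

theorem preservesFiniteColimits_comp_homComplex {𝒜 : Type*} [Category* 𝒜] [Abelian 𝒜]
    (F : 𝒜 ⥤ 𝒞) [F.Additive] [PreservesFiniteLimits F] (X : SimplicialObject 𝒞)
    (h : ∀ {A B : 𝒜} (f : A ⟶ B) [Epi f] (n : ℕ) (φ : X _⦋n⦌ ⟶ F.obj B),
      ∃ ψ, ψ ≫ F.map f = φ) :
    PreservesFiniteColimits (F ⋙ homComplex X) where
  preservesFiniteColimits J _ _ := preservesColimitsOfShape_of_eval _ fun n => by
    let T : 𝒜 ⥤ AddCommGrpCat := F ⋙ preadditiveCoyoneda.obj (op (X _⦋n⦌))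
    have : T.PreservesEpimorphisms :=
      ⟨fun f _ => (AddCommGrpCat.epi_iff_surjective _).2 fun φ => h f n φ⟩
    have := T.preservesHomology_of_preservesEpis_and_kernels
    have := T.preservesFiniteColimits_of_preservesHomology
    exact inferInstanceAs (PreservesColimitsOfShape J T)

end Preadditive

theorem exactAt_homComplex [Abelian 𝒞] {X : SimplicialObject 𝒞} {n : ℕ}
    (h : ((alternatingFaceMapComplex 𝒞).obj X).ExactAt (n + 1)) (P : 𝒞) [Injective P] :
    ((homComplex X).obj P).ExactAt (n + 1) := by
  rw [exactAt_iff' _ n (n + 1) (n + 2) (by simp) (by simp), ShortComplex.ab_exact_iff]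
  intro (φ : X _⦋n + 1⦌ ⟶ P) hφ
  rw [exactAt_iff' _ (n + 2) (n + 1) n (by simp) (by simp)] at h
  have hφ' : ((alternatingFaceMapComplex 𝒞).obj X).d (n + 2) (n + 1) ≫ φ = 0 :=
    (congrArg (· ≫ φ) (alternatingFaceMapComplex_obj_d X (n + 1))).trans
      ((homComplex_d_apply X P (n + 1) φ).symm.trans hφ)
  refine ⟨h.descToInjective φ hφ', ?_⟩
  refine (homComplex_d_apply X P n _).trans (Eq.trans ?_ (h.comp_descToInjective φ hφ'))
  exact congrArg (· ≫ h.descToInjective φ hφ') (alternatingFaceMapComplex_obj_d X n).symm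

end HomComplex

section FreePresheaf

variable {D : Type*} [Category.{v} D]

/-- The free presheaf of abelian groups on a presheaf of sets. -/
abbrev freePresheaf (F : Dᵒᵖ ⥤ Type w) : Dᵒᵖ ⥤ AddCommGrpCat.{w} := F ⋙ AddCommGrpCat.free

/-- The universal property of the free presheaf of abelian groups. -/
def freePresheafHomEquiv {F : Dᵒᵖ ⥤ Type w} {P : Dᵒᵖ ⥤ AddCommGrpCat.{w}} :
    (freePresheaf F ⟶ P) ≃ (F ⟶ P ⋙ forget AddCommGrpCat) :=
  (AddCommGrpCat.adj.whiskerRight Dᵒᵖ).homEquiv F P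

theorem freePresheafHomEquiv_symm_app_of {F : Dᵒᵖ ⥤ Type w} {P : Dᵒᵖ ⥤ AddCommGrpCat.{w}}
    (t : F ⟶ P ⋙ forget AddCommGrpCat) (Y : Dᵒᵖ) (x : F.obj Y) :
    (freePresheafHomEquiv.symm t).app Y (FreeAbelianGroup.of x) = t.app Y x :=
  FreeAbelianGroup.lift_apply_of _ _

theorem freePresheaf_hom_ext {F : Dᵒᵖ ⥤ Type w} {P : Dᵒᵖ ⥤ AddCommGrpCat.{w}}
    {φ ψ : freePresheaf F ⟶ P}
    (h : ∀ Y x, φ.app Y (FreeAbelianGroup.of x) = ψ.app Y (FreeAbelianGroup.of x)) : φ = ψ :=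
  freePresheafHomEquiv.injective <| NatTrans.ext <| funext fun Y =>
    ConcreteCategory.hom_ext _ _ (h Y)

theorem exists_lift_of_retract {F : Dᵒᵖ ⥤ Type (max w v)} {R : D}
    (r : Retract F (uliftYoneda.{w}.obj R)) {P Q : Dᵒᵖ ⥤ AddCommGrpCat.{max w v}} (f : P ⟶ Q)
    (hf : Function.Surjective (f.app (op R))) (φ : freePresheaf F ⟶ Q) :
    ∃ ψ, ψ ≫ f = φ := by
  let U := Functor.whiskerRight f (forget AddCommGrpCat)
  obtain ⟨a, ha⟩ := hf (uliftYonedaEquiv (r.r ≫ freePresheafHomEquiv φ))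
  let α : uliftYoneda.{w}.obj R ⟶ P ⋙ forget _ := uliftYonedaEquiv.symm a
  have hα : α ≫ U = r.r ≫ freePresheafHomEquiv φ :=
    uliftYonedaEquiv.injective <| by
      rw [uliftYonedaEquiv_comp, Equiv.apply_symm_apply]
      exact ha
  refine ⟨freePresheafHomEquiv.symm (r.i ≫ α), freePresheafHomEquiv.injective ?_⟩
  calc freePresheafHomEquiv (freePresheafHomEquiv.symm (r.i ≫ α) ≫ f)
      = freePresheafHomEquiv (freePresheafHomEquiv.symm (r.i ≫ α)) ≫ U :=
        Adjunction.homEquiv_naturality_right ..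
    _ = freePresheafHomEquiv φ := by
        rw [Equiv.apply_symm_apply, Category.assoc, hα, r.retract_assoc]

end FreePresheaf

section Tuples

variable {C : Type u} [Category.{v} C]

namespace Twist

/-- The presheaf on the twisted site whose sections over `X` are the families of sections of `𝒢`
over `X` indexed by `ι`, with `𝒢` acting by diagonal left multiplication. -/
def tuples (𝒢 : Cᵒᵖ ⥤ GrpCat.{v}) (ι : Type) : (Twist 𝒢)ᵒᵖ ⥤ Type (max u v) where
  obj Y := ULift.{u} (ι → 𝒢.obj (op Y.unop.base))
  map f := ↾fun x => ⟨fun i => f.unop.tw * 𝒢.map f.unop.base.op (x.down i)⟩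
  map_id Y := by
    refine ConcreteCategory.hom_ext _ _ fun x => ?_
    apply ULift.down_injective
    funext i
    simp
  map_comp f g := by
    refine ConcreteCategory.hom_ext _ _ fun x => ?_
    apply ULift.down_injective
    funext i
    simp [mul_assoc]

variable {𝒢 : Cᵒᵖ ⥤ GrpCat.{v}}

/-- Reindexing of tuples along a map of index sets. -/
def tuplesMap {ι κ : Type} (s : ι → κ) : tuples 𝒢 κ ⟶ tuples 𝒢 ι where
  app Y := ↾fun x : ULift (κ → 𝒢.obj (op Y.unop.base)) => ULift.up.{u} (x.down ∘ s)

variable (𝒢) in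
/-- The simplicial presheaf on the twisted site of nonempty tuples of sections of `𝒢`, with faces
given by omission of entries; this is `E_•𝒢`. -/
def simplicialTuples : SimplicialObject ((Twist 𝒢)ᵒᵖ ⥤ Type (max u v)) where
  obj n := tuples 𝒢 (Fin (n.unop.len + 1))
  map φ := tuplesMap φ.unop.toOrderHom

variable (𝒢) in
/-- The simplicial presheaf of free abelian groups on `E_•𝒢`. -/
def freeTuples : SimplicialObject ((Twist 𝒢)ᵒᵖ ⥤ AddCommGrpCat.{max u v}) :=
  ((SimplicialObject.whiskering _ _).obj ((Functor.whiskeringRight _ _ _).obj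
    AddCommGrpCat.free)).obj (simplicialTuples 𝒢)

/-- Prepending the unit section to tuples. This is natural only for untwisted morphisms. -/
def tuplesCons (n : ℕ) (Y : (Twist 𝒢)ᵒᵖ) :
    (tuples 𝒢 (Fin n)).obj Y ⟶ (tuples 𝒢 (Fin (n + 1))).obj Y :=
  ↾fun x : ULift (Fin n → 𝒢.obj (op Y.unop.base)) => ULift.up.{u} (Fin.cons 1 x.down)

theorem tuplesCons_comp_tuplesMap_zero (n : ℕ) (Y : (Twist 𝒢)ᵒᵖ) :
    tuplesCons n Y ≫ (tuplesMap (Fin.succAbove 0)).app Y = 𝟙 _ := rfl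

theorem tuplesCons_comp_tuplesMap_succ {n : ℕ} (j : Fin (n + 1)) (Y : (Twist 𝒢)ᵒᵖ) :
    tuplesCons (n + 1) Y ≫ (tuplesMap j.succ.succAbove).app Y =
      (tuplesMap j.succAbove).app Y ≫ tuplesCons n Y := by
  refine ConcreteCategory.hom_ext _ _ fun x => ?_
  apply ULift.down_injective
  funext i
  cases i using Fin.cases with
  | zero => rfl
  | succ i =>
    exact congrArg (Fin.cons 1 x.down : Fin (n + 2) → 𝒢.obj (op Y.unop.base))
      (Fin.succ_succAbove_succ j i)

/-- Exactness is checked on sections, where `(x₀, …, xₙ) ↦ (1, x₀, …, xₙ)` is a contraction. -/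
theorem exactAt_freeTuples (n : ℕ) :
    ((alternatingFaceMapComplex _).obj (freeTuples 𝒢)).ExactAt (n + 1) := by
  refine exact_of_evaluation _ fun Y => ?_
  let ev := (evaluation (Twist 𝒢)ᵒᵖ AddCommGrpCat.{max u v}).obj Y
  let X := ((SimplicialObject.whiskering _ _).obj ev).obj (freeTuples 𝒢)
  have hX : ((alternatingFaceMapComplex _).obj X).ExactAt (n + 1) :=
    exactAt_alternatingFaceMapComplex X (fun n => AddCommGrpCat.free.map (tuplesCons (n + 1) Y))
      (fun n => by
        refine (AddCommGrpCat.free.map_comp _ _).symm.trans ?_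
        exact (congrArg _ (tuplesCons_comp_tuplesMap_zero (n + 1) Y)).trans
          (AddCommGrpCat.free.map_id _))
      (fun n j => by
        refine (AddCommGrpCat.free.map_comp _ _).symm.trans ?_
        exact (congrArg _ (tuplesCons_comp_tuplesMap_succ j Y)).trans
          (AddCommGrpCat.free.map_comp _ _)) n
  have e := Functor.congr_obj (map_alternatingFaceMapComplex ev) (freeTuples 𝒢)
  rw [show (alternatingFaceMapComplex _).obj X = _ from e.symm] at hX
  exact hX

end Twist
end Tuples

section ZerothHomology

variable {𝒜 ℬ : Type*} [Category* 𝒜] [Category* ℬ] [Abelian ℬ]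

/-- A functor which is identified, by a natural transformation, with the kernels of `d⁰` in a
functorial cochain complex `T` is identified with `H⁰ ∘ T`. -/
noncomputable def isoHomologyCompZero {F : 𝒜 ⥤ ℬ} {T : 𝒜 ⥤ CochainComplex ℬ ℕ}
    (α : F ⟶ T ⋙ eval ℬ (.up ℕ) 0) [∀ A, Mono (α.app A)]
    (hα : ∀ A, α.app A ≫ (T.obj A).d 0 1 = 0)
    (h : ∀ A, (ShortComplex.mk _ _ (hα A)).Exact) : F ≅ homologyComp T 0 :=
  let e (A : 𝒜) : F.obj A ≅ (T.obj A).cycles 0 :=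
    (h A).fIsKernel.conePointUniqueUpToIso ((T.obj A).cyclesIsKernel 0 1 (by simp))
  have he (A : 𝒜) : (e A).hom ≫ (T.obj A).iCycles 0 = α.app A :=
    (h A).fIsKernel.conePointUniqueUpToIso_hom_comp _ WalkingParallelPair.zero
  NatIso.ofComponents (fun A => e A ≪≫ (T.obj A).isoHomologyπ₀) fun {A B} f => by
    have : F.map f ≫ (e B).hom = (e A).hom ≫ cyclesMap (T.map f) 0 := by
      rw [← cancel_mono ((T.obj B).iCycles 0), Category.assoc, Category.assoc, he, cyclesMap_i,
        reassoc_of% he]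
      exact α.naturality f
    change F.map f ≫ (e B).hom ≫ (T.obj B).homologyπ 0 =
      ((e A).hom ≫ (T.obj A).homologyπ 0) ≫ homologyMap (T.map f) 0
    rw [reassoc_of% this, Category.assoc, homologyπ_naturality]

end ZerothHomology

section Tuples

variable {C : Type u} [Category.{v} C]

/-- The presheaf of families of sections of `𝒢` indexed by `ι`, i.e. the `ι`-th power of `𝒢`. -/
def powerPresheaf (𝒢 : Cᵒᵖ ⥤ GrpCat.{v}) (ι : Type) : Cᵒᵖ ⥤ Type v where
  obj U := ι → 𝒢.obj U
  map f := ↾fun x i => 𝒢.map f (x i)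

namespace Twist

variable {𝒢 : Cᵒᵖ ⥤ GrpCat.{v}} {ι : Type} {R : C} (h : (powerPresheaf 𝒢 ι).RepresentableBy R)

theorem tuples_map_homEquiv_id {Y : Twist 𝒢} (f : Y ⟶ ⟨R⟩) (i : ι) :
    ((tuples 𝒢 ι).map f.op (ULift.up.{u} (h.homEquiv (𝟙 R)))).down i =
      f.tw * h.homEquiv f.base i :=
  congrArg (f.tw * ·) (congrFun (h.homEquiv_eq f.base).symm i)

/-- If `R` represents the `ι`-th power of `𝒢`, the presheaf `𝒢^ι` on the twisted site is a retract
of the presheaf represented by `R`: a tuple `x` corresponds to the morphism to `R` with base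
`x i₀⁻¹ x` and twist `x i₀`. -/
def tuplesRetract (i₀ : ι) : Retract (tuples 𝒢 ι) (uliftYoneda.{u}.obj (⟨R⟩ : Twist 𝒢)) where
  i :=
    { app Y := ↾fun x : ULift (ι → 𝒢.obj (op Y.unop.base)) => ULift.up.{u}
        (homMk (h.homEquiv.symm fun i => (x.down i₀)⁻¹ * x.down i) (x.down i₀))
      naturality Y Z f := by
        refine ConcreteCategory.hom_ext _ _ fun x => ?_
        refine congrArg ULift.up.{u} (hom_ext ?_ rfl)
        refine Eq.trans ?_ (h.comp_homEquiv_symm _ f.unop.base).symm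
        refine congrArg h.homEquiv.symm (funext fun i => ?_)
        change (f.unop.tw * 𝒢.map f.unop.base.op (x.down i₀))⁻¹ *
          (f.unop.tw * 𝒢.map f.unop.base.op (x.down i)) =
          𝒢.map f.unop.base.op ((x.down i₀)⁻¹ * x.down i)
        rw [map_mul, map_inv, mul_inv_rev, mul_assoc, inv_mul_cancel_left] }
  r := uliftYonedaEquiv.symm (ULift.up.{u} (h.homEquiv (𝟙 R)))
  retract := by
    refine NatTrans.ext (funext fun Y => ConcreteCategory.hom_ext _ _ fun x => ?_)
    apply ULift.down_injective
    funext i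
    refine (tuples_map_homEquiv_id h _ i).trans ?_
    exact (congrArg (x.down i₀ * ·) (congrFun (h.homEquiv.apply_symm_apply _) i)).trans
      (mul_inv_cancel_left _ _)

end Twist

end Tuples

theorem objD_zero_comp_eq_zero_iff {𝒞 : Type*} [Category* 𝒞] [Preadditive 𝒞]
    {X : SimplicialObject 𝒞} {P : 𝒞} {φ : X _⦋0⦌ ⟶ P} :
    AlternatingFaceMapComplex.objD X 0 ≫ φ = 0 ↔ X.δ 0 ≫ φ = X.δ 1 ≫ φ := by
  rw [AlternatingFaceMapComplex.objD, Fin.sum_univ_two, Fin.val_zero, Fin.val_one, pow_zero,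
    pow_one, one_smul, neg_one_zsmul, ← sub_eq_add_neg, Preadditive.sub_comp, sub_eq_zero]

section EquivariantCochains

variable {C : Type u} [Category.{v} C] {J : GrothendieckTopology C} {𝒢 : Cᵒᵖ ⥤ GrpCat.{v}}

namespace EquivariantSheaf

theorem injective_toPresheaf (A : EquivariantSheaf J 𝒢 AddCommGrpCat.{max u v}) [Injective A] :
    Injective A.toPresheaf := by
  have : Injective ((toSheafTwist J 𝒢 _).obj A) :=
    Injective.injective_of_adjoint (toSheafTwist J 𝒢 _).asEquivalence.symm.toAdjunction A
  exact Injective.injective_of_adjoint (sheafificationAdjunction (Twist.topology 𝒢 J)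
    AddCommGrpCat.{max u v}) ((toSheafTwist J 𝒢 _).obj A)

variable (J 𝒢) in
/-- The functor sending an equivariant sheaf to the associated presheaf on the twisted site. -/
abbrev toPresheafFunctor : EquivariantSheaf J 𝒢 AddCommGrpCat.{max u v} ⥤
    (Twist 𝒢)ᵒᵖ ⥤ AddCommGrpCat.{max u v} :=
  toSheafTwist J 𝒢 _ ⋙ sheafToPresheaf _ _

instance : (toSheafTwist J 𝒢 AddCommGrpCat.{max u v}).Additive where

variable (J 𝒢) in
/-- The complex of homogeneous cochains of `𝒢` with values in an equivariant sheaf: the `n`-cochains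
are the equivariant morphisms from `𝒢ⁿ⁺¹`, i.e. the morphisms from the free presheaf of abelian
groups on `𝒢ⁿ⁺¹` over the twisted site. -/
noncomputable def homogeneousComplex : EquivariantSheaf J 𝒢 AddCommGrpCat.{max u v} ⥤
    CochainComplex AddCommGrpCat.{max u v} ℕ :=
  toPresheafFunctor J 𝒢 ⋙ homComplex (Twist.freeTuples 𝒢)

instance : (homogeneousComplex J 𝒢).Additive :=
  inferInstanceAs (toPresheafFunctor J 𝒢 ⋙ homComplex (Twist.freeTuples 𝒢)).Additive

instance : PreservesFiniteLimits (homogeneousComplex J 𝒢) :=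
  inferInstanceAs (PreservesFiniteLimits
    (toPresheafFunctor J 𝒢 ⋙ homComplex (Twist.freeTuples 𝒢)))

theorem exactAt_homogeneousComplex (A : EquivariantSheaf J 𝒢 AddCommGrpCat.{max u v})
    [Injective A] (n : ℕ) : ((homogeneousComplex J 𝒢).obj A).ExactAt (n + 1) :=
  have := A.injective_toPresheaf
  exactAt_homComplex (Twist.exactAt_freeTuples n) A.toPresheaf

section ZeroCocycles

variable {A : EquivariantSheaf J 𝒢 AddCommGrpCat.{max u v}}

theorem mem_invariants_iff {s : ∀ X : C, A.sheaf.obj.obj (op X)} :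
    s ∈ A.invariants ↔
      ∀ ⦃Y Z : Twist 𝒢⦄ (f : Y ⟶ Z), A.toPresheaf.map f.op (s Z.base) = s Y.base := by
  refine ⟨fun hs Y Z f => ?_, fun hs => ⟨fun X Y f => ?_, fun X g => ?_⟩⟩
  · exact (congrArg (A.actHom f.tw) (hs.1 f.base)).trans (hs.2 Y.base f.tw)
  · exact (ConcreteCategory.congr_hom (A.toPresheaf_map_incl f) (s Y)).symm.trans
      (hs ((Twist.incl 𝒢).map f))
  · refine Eq.trans (congrArg (A.actHom g) ?_) (hs (Twist.homMk (𝟙 X) g : (⟨X⟩ : Twist 𝒢) ⟶ ⟨X⟩))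
    exact (ConcreteCategory.congr_hom (A.sheaf.obj.map_id _) _).symm

/-- An invariant section, regarded as a constant map. -/
def constMap (F : (Twist 𝒢)ᵒᵖ ⥤ Type (max u v)) (s : A.invariants) :
    F ⟶ A.toPresheaf ⋙ forget AddCommGrpCat where
  app Y := ↾fun _ => s.1 Y.unop.base
  naturality _ _ f := ConcreteCategory.hom_ext _ _ fun _ =>
    (mem_invariants_iff.1 s.2 f.unop).symm

/-- The cochain whose value is a given invariant section. -/
def constCochain (F : (Twist 𝒢)ᵒᵖ ⥤ Type (max u v)) :
    A.invariants →+ (freePresheaf F ⟶ A.toPresheaf) where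
  toFun s := freePresheafHomEquiv.symm (constMap F s)
  map_zero' := freePresheaf_hom_ext fun _ _ => freePresheafHomEquiv_symm_app_of ..
  map_add' s t := freePresheaf_hom_ext fun Y x =>
    (freePresheafHomEquiv_symm_app_of (constMap F (s + t)) Y x).trans (congrArg₂ (· + ·)
      (freePresheafHomEquiv_symm_app_of (constMap F s) Y x)
      (freePresheafHomEquiv_symm_app_of (constMap F t) Y x)).symm

theorem constCochain_app_of (F : (Twist 𝒢)ᵒᵖ ⥤ Type (max u v)) (s : A.invariants)
    (Y : (Twist 𝒢)ᵒᵖ) (x : F.obj Y) :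
    (constCochain F s).app Y (FreeAbelianGroup.of x) = s.1 Y.unop.base :=
  freePresheafHomEquiv_symm_app_of (constMap F s) Y x

theorem whiskerRight_comp_constCochain {F F' : (Twist 𝒢)ᵒᵖ ⥤ Type (max u v)} (α : F ⟶ F')
    (s : A.invariants) :
    Functor.whiskerRight α AddCommGrpCat.free ≫ constCochain F' s = constCochain F s :=
  freePresheaf_hom_ext fun Y x =>
    (constCochain_app_of F' s Y (α.app Y x)).trans (constCochain_app_of F s Y x).symm

theorem objD_comp_constCochain (s : A.invariants) :
    AlternatingFaceMapComplex.objD (Twist.freeTuples 𝒢) 0 ≫ constCochain _ s = 0 :=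
  objD_zero_comp_eq_zero_iff.2 <|
    (whiskerRight_comp_constCochain (Twist.tuplesMap (Fin.succAbove 0)) s).trans
      (whiskerRight_comp_constCochain (Twist.tuplesMap (Fin.succAbove 1)) s).symm

theorem constCochain_injective :
    Function.Injective (constCochain (A := A) (Twist.tuples 𝒢 (Fin 1))) := fun s t h =>
  Subtype.ext <| funext fun X => by
    let x : (Twist.tuples 𝒢 (Fin 1)).obj (op ⟨X⟩) := ULift.up.{u} 1
    exact (constCochain_app_of _ s (op ⟨X⟩) x).symm.trans
      ((ConcreteCategory.congr_hom (NatTrans.congr_app h _) _).trans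
        (constCochain_app_of _ t (op ⟨X⟩) x))

/-- A degree-zero cocycle `φ` satisfies `φ x₀ = φ x₁` for all sections `x₀, x₁` of `𝒢`. -/
theorem exists_constCochain_eq {φ : freePresheaf (Twist.tuples 𝒢 (Fin 1)) ⟶ A.toPresheaf}
    (h : AlternatingFaceMapComplex.objD (Twist.freeTuples 𝒢) 0 ≫ φ = 0) :
    ∃ s, constCochain _ s = φ := by
  replace h : Functor.whiskerRight (Twist.tuplesMap (Fin.succAbove 0)) AddCommGrpCat.free ≫ φ =
      Functor.whiskerRight (Twist.tuplesMap (Fin.succAbove 1)) AddCommGrpCat.free ≫ φ :=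
    objD_zero_comp_eq_zero_iff.1 h
  have value_eq (Y : (Twist 𝒢)ᵒᵖ) (x y : (Twist.tuples 𝒢 (Fin 1)).obj Y) :
      φ.app Y (FreeAbelianGroup.of x) = φ.app Y (FreeAbelianGroup.of y) := by
    let z : (Twist.tuples 𝒢 (Fin 2)).obj Y := ULift.up.{u} ![y.down 0, x.down 0]
    have hx : (Twist.tuplesMap (Fin.succAbove 0)).app Y z = x := by
      apply ULift.down_injective
      funext i
      rw [Subsingleton.elim i 0]
      rfl
    have hy : (Twist.tuplesMap (Fin.succAbove 1)).app Y z = y := by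
      apply ULift.down_injective
      funext i
      rw [Subsingleton.elim i 0]
      rfl
    rw [← hx, ← hy]
    exact ConcreteCategory.congr_hom (NatTrans.congr_app h Y) (FreeAbelianGroup.of z)
  let one (Y : (Twist 𝒢)ᵒᵖ) : (Twist.tuples 𝒢 (Fin 1)).obj Y := ULift.up.{u} 1
  let s (X : C) : A.sheaf.obj.obj (op X) := φ.app (op ⟨X⟩) (FreeAbelianGroup.of (one _))
  have hs : s ∈ A.invariants := mem_invariants_iff.2 fun Y Z f =>
    (ConcreteCategory.congr_hom (φ.naturality f.op) (FreeAbelianGroup.of (one _))).symm.trans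
      (value_eq _ ((Twist.tuples 𝒢 (Fin 1)).map f.op (one _)) _)
  exact ⟨⟨s, hs⟩, freePresheaf_hom_ext fun Y x =>
    (constCochain_app_of _ _ Y x).trans (value_eq Y _ x)⟩

end ZeroCocycles

/-- `Γ` is the degree-zero homology of the complex of homogeneous cochains. -/
noncomputable def globalSectionsIso :
    globalSections J 𝒢 ≅ homologyComp (homogeneousComplex J 𝒢) 0 :=
  let α : globalSections J 𝒢 ⟶ homogeneousComplex J 𝒢 ⋙ eval AddCommGrpCat (.up ℕ) 0 :=
    { app A := AddCommGrpCat.ofHom (constCochain (A := A) (Twist.tuples 𝒢 (Fin 1)))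
      naturality A B f := by
        refine ConcreteCategory.hom_ext _ _ fun s => freePresheaf_hom_ext fun Y x => ?_
        exact (constCochain_app_of _ _ Y x).trans
          (congrArg (f.hom.hom.app (op Y.unop.base)) (constCochain_app_of _ s Y x)).symm }
  have (A : EquivariantSheaf J 𝒢 AddCommGrpCat.{max u v}) : Mono (α.app A) :=
    (AddCommGrpCat.mono_iff_injective _).2 constCochain_injective
  isoHomologyCompZero α
    (fun A => ConcreteCategory.hom_ext _ _ fun s =>
      (homComplex_d_apply (Twist.freeTuples 𝒢) A.toPresheaf 0 _).trans (objD_comp_constCochain s))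
    fun A => (ShortComplex.ab_exact_iff _).2 fun φ hφ => exists_constCochain_eq
      ((homComplex_d_apply (Twist.freeTuples 𝒢) A.toPresheaf 0 φ).symm.trans hφ)

theorem exists_homogeneousCochain_lift {A B : EquivariantSheaf J 𝒢 AddCommGrpCat.{max u v}}
    {f : A ⟶ B} {ι : Type} [Nonempty ι] {R : C} (h : (powerPresheaf 𝒢 ι).RepresentableBy R)
    (hf : Function.Surjective (f.hom.hom.app (op R)))
    (φ : freePresheaf (Twist.tuples 𝒢 ι) ⟶ B.toPresheaf) :
    ∃ ψ, ψ ≫ (toPresheafFunctor J 𝒢).map f = φ :=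
  exists_lift_of_retract (Twist.tuplesRetract h (Classical.arbitrary ι)) _ hf φ

/-- Homogeneous cochains compute the cohomology of equivariant sheaves if the powers of `𝒢` are
representable and epimorphisms of equivariant sheaves are surjective on sections over them. -/
noncomputable def cohomologyIso {R : ℕ → C}
    (h : ∀ n, (powerPresheaf 𝒢 (Fin (n + 1))).RepresentableBy (R n))
    (hR : ∀ {A B : EquivariantSheaf J 𝒢 AddCommGrpCat.{max u v}} (f : A ⟶ B) [Epi f] (n : ℕ),
      Function.Surjective (f.hom.hom.app (op (R n)))) (n : ℕ) :
    cohomology J 𝒢 n ≅ homologyComp (homogeneousComplex J 𝒢) n :=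
  have : PreservesFiniteColimits (homogeneousComplex J 𝒢) :=
    preservesFiniteColimits_comp_homComplex _ _ fun f _ n =>
      exists_homogeneousCochain_lift (h n) (hR f n)
  rightDerivedMapIso globalSectionsIso n ≪≫
    rightDerivedIsoHomology (fun I _ n => exactAt_homogeneousComplex I n) n

end EquivariantSheaf

end EquivariantCochains

end HomogeneousCochains

section Ultraparacompact

open Topology Set

theorem exists_isClopen_between {M : Type*} [PseudoMetricSpace M] [IsUltrametricDist M]
    {F V : Set M} (hF : IsClosed F) (hV : IsOpen V) (hFV : F ⊆ V) :
    ∃ D, IsClopen D ∧ F ⊆ D ∧ D ⊆ V := by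
  choose! r hr hrV using fun x (hx : x ∈ F) => Metric.isOpen_iff.1 hV x (hFV hx)
  refine ⟨⋃ x ∈ F, Metric.ball x (r x), ⟨⟨?_⟩, ?_⟩,
    fun x hx => mem_biUnion hx (Metric.mem_ball_self (hr x hx)), iUnion₂_subset hrV⟩
  · rw [Metric.isOpen_iff]
    intro y hy
    have hyF : y ∉ F := fun h => hy (mem_biUnion h (Metric.mem_ball_self (hr y h)))
    obtain ⟨δ, hδ, hball⟩ := Metric.isOpen_iff.1 hF.isOpen_compl y hyF
    refine ⟨δ, hδ, fun z hz hzD => ?_⟩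
    obtain ⟨x, hx, hzx⟩ := mem_iUnion₂.1 hzD
    rcases le_max_iff.1 (dist_triangle_max y z x) with h | h
    · rw [dist_comm y x, dist_comm y z] at h
      exact hball (Metric.mem_ball.2 (h.trans_lt hz)) hx
    · exact hy (mem_biUnion hx (Metric.mem_ball.2 (h.trans_lt hzx)))
  · exact isOpen_biUnion fun _ _ => Metric.isOpen_ball

theorem exists_isClopen_between_of_isInducing {X M : Type*} [TopologicalSpace X]
    [PseudoMetricSpace M] [IsUltrametricDist M] {φ : X → M} (hφ : IsInducing φ) {F V : Set X}
    (hF : IsClosed F) (hV : IsOpen V) (hFV : F ⊆ V) : ∃ D, IsClopen D ∧ F ⊆ D ∧ D ⊆ V := by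
  let _ := hφ.comapPseudoMetricSpace
  have : IsUltrametricDist X := ⟨fun x y z => dist_triangle_max (φ x) (φ y) (φ z)⟩
  exact exists_isClopen_between hF hV hFV

theorem exists_isClopen_between_of_chart {X M : Type*} [TopologicalSpace X] [PseudoMetricSpace M]
    [IsUltrametricDist M] (e : OpenPartialHomeomorph X M) {F V : Set X} (hF : IsClosed F)
    (hV : IsOpen V) (hFV : F ⊆ V) (hVe : closure V ⊆ e.source) :
    ∃ D, IsClopen D ∧ F ⊆ D ∧ D ⊆ V := by
  obtain ⟨D, hD, hFD, hDV⟩ := exists_isClopen_between_of_isInducing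
    e.isOpenEmbedding_restrict.isInducing (hF.preimage continuous_subtype_val)
    (hV.preimage continuous_subtype_val) (preimage_mono hFV)
  obtain ⟨C, hC, rfl⟩ := isClosed_induced_iff.1 hD.isClosed
  have hVs : V ⊆ e.source := subset_closure.trans hVe
  have hD_eq : e.source ∩ C = closure V ∩ C := by
    refine Subset.antisymm (fun x hx => ⟨subset_closure (?_ : x ∈ V), hx.2⟩)
      (inter_subset_inter_left _ hVe)
    exact hDV (a := ⟨x, hx.1⟩) hx.2
  refine ⟨e.source ∩ C, ⟨?_, ?_⟩, fun x hx => ⟨hVs (hFV hx), ?_⟩, fun x hx => ?_⟩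
  · exact hD_eq ▸ isClosed_closure.inter hC
  · rw [← Subtype.image_preimage_coe]
    exact e.open_source.isOpenMap_subtype_val _ hD.isOpen
  · exact hFD (a := ⟨x, hVs (hFV hx)⟩) hx
  · exact hDV (a := ⟨x, hx.1⟩) hx.2

theorem isLocallyConstant_setOf_mem {X ι : Type*} [TopologicalSpace X] {D : ι → Set X}
    (hD : ∀ i, IsClopen (D i)) (hDf : LocallyFinite D) :
    IsLocallyConstant fun x => { i | x ∈ D i } := by
  rw [IsLocallyConstant.iff_eventually_eq]
  intro x
  obtain ⟨W, hW, hfin⟩ := hDf x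
  have mem_iff (i : ι) : ∀ᶠ y in 𝓝 x, y ∈ D i ↔ x ∈ D i := by
    by_cases hx : x ∈ D i
    · filter_upwards [(hD i).isOpen.mem_nhds hx] with y hy using iff_of_true hy hx
    · filter_upwards [(hD i).compl.isOpen.mem_nhds hx] with y hy using iff_of_false hy hx
  filter_upwards [hW, (Filter.eventually_all_finite hfin).2 fun i _ => mem_iff i] with y hy h
  ext i
  by_cases hi : (D i ∩ W).Nonempty
  · exact h i hi
  · exact iff_of_false (fun hyi => hi ⟨y, hyi, hy⟩) fun hxi => hi ⟨x, hxi, mem_of_mem_nhds hW⟩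

theorem exists_isLocallyConstant_mem_of_locallyFinite {X ι : Type*} [TopologicalSpace X]
    {D : ι → Set X} (hD : ∀ i, IsClopen (D i)) (hDf : LocallyFinite D) (hDc : ⋃ i, D i = univ) :
    ∃ c : X → ι, IsLocallyConstant c ∧ ∀ x, x ∈ D (c x) := by
  have hne (x : X) : { i | x ∈ D i }.Nonempty := mem_iUnion.1 (hDc.ge (mem_univ x))
  let s (x : X) : { t : Set ι // t.Nonempty } := ⟨{ i | x ∈ D i }, hne x⟩
  have hs : IsLocallyConstant s :=
    (isLocallyConstant_setOf_mem hD hDf).desc s Subtype.val Subtype.val_injective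
  exact ⟨fun x => (s x).2.some, hs.comp fun t => t.2.some, fun x => (s x).2.some_mem⟩

/-- This is strict paracompactness: the fibres of `c` are a partition into open subsets, which
refines the covering by the interiors of the `U x`. -/
theorem exists_isLocallyConstant_mem {X M : Type*} [TopologicalSpace X] [T2Space X]
    [ParacompactSpace X] [PseudoMetricSpace M] [IsUltrametricDist M]
    (he : ∀ x : X, ∃ e : OpenPartialHomeomorph X M, x ∈ e.source) {U : X → Set X}
    (hU : ∀ x, U x ∈ 𝓝 x) : ∃ c : X → X, IsLocallyConstant c ∧ ∀ y, y ∈ U (c y) := by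
  choose e hxe using he
  choose W hW hWc hWU using fun x => exists_mem_nhds_isClosed_subset
    (Filter.inter_mem (hU x) ((e x).open_source.mem_nhds (hxe x)))
  obtain ⟨V, hVo, hVc, hVf, hVW⟩ := precise_refinement (fun x => interior (W x))
    (fun _ => isOpen_interior)
    (eq_univ_of_forall fun x => mem_iUnion.2 ⟨x, mem_interior_iff_mem_nhds.2 (hW x)⟩)
  replace hVW (x : X) : closure (V x) ⊆ U x ∩ (e x).source :=
    (closure_minimal ((hVW x).trans interior_subset) (hWc x)).trans (hWU x)
  obtain ⟨F, hFc, hF, hFV⟩ := exists_iUnion_eq_closed_subset hVo hVf.point_finite hVc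
  choose D hD hFD hDV using fun x => exists_isClopen_between_of_chart (e x) (hF x) (hVo x) (hFV x)
    ((hVW x).trans inter_subset_right)
  obtain ⟨c, hc, hcD⟩ := exists_isLocallyConstant_mem_of_locallyFinite hD (hVf.subset hDV)
    (univ_subset_iff.1 (hFc ▸ iUnion_mono hFD))
  exact ⟨c, hc, fun y => (hVW _ (subset_closure (hDV _ (hcD y)))).1⟩

end Ultraparacompact

section SurjectiveOnSections

theorem EquivariantSheaf.imageSieve_mem_of_epi {C : Type u} [Category.{v} C]
    {J : GrothendieckTopology C} {𝒢 : Cᵒᵖ ⥤ GrpCat.{v}}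
    {A B : EquivariantSheaf J 𝒢 AddCommGrpCat.{max u v}} (f : A ⟶ B) [Epi f] {X : C}
    (b : B.sheaf.obj.obj (op X)) : Presheaf.imageSieve f.hom.hom b ∈ J X := by
  have hf : Sheaf.IsLocallySurjective ((toSheafTwist J 𝒢 _).map f) :=
    (Sheaf.isLocallySurjective_iff_epi' _ _).2 inferInstance
  refine J.superset_covering ?_ (hf.imageSieve_mem (U := ⟨X⟩) b)
  rintro Y g ⟨a, ha⟩
  exact ⟨a, ha.trans (ConcreteCategory.congr_hom (B.toPresheaf_map_incl g) b)⟩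

theorem EquivariantSheaf.isSheaf_forget {C : Type u} [Category.{v} C] {J : GrothendieckTopology C}
    {𝒢 : Cᵒᵖ ⥤ GrpCat.{v}} (A : EquivariantSheaf J 𝒢 AddCommGrpCat.{max u v}) :
    Presieve.IsSheaf J (A.sheaf.obj ⋙ forget AddCommGrpCat.{max u v}) :=
  (isSheaf_iff_isSheaf_of_type _ _).1
    ((Presheaf.isSheaf_iff_isSheaf_forget _ _ (forget AddCommGrpCat.{max u v})).1 A.sheaf.property)

namespace La

variable {K : Type u} [NontriviallyNormedField K]

theorem comp_toOpen {X Y Z : La K} {U : TopologicalSpace.Opens X.carrier}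
    [ParacompactSpace U] (g : Z ⟶ Y) (f : Y ⟶ X) (h : ∀ y, fn f y ∈ U) :
    g ≫ toOpen f h = toOpen (g ≫ f) fun z => h (fn g z) :=
  rfl

theorem exists_isLocallyConstant_mem [CompleteSpace K] [IsUltrametricDist K] (X : La K)
    {U : X.carrier → Set X.carrier} (hU : ∀ x, U x ∈ nhds x) :
    ∃ c : X.carrier → X.carrier, IsLocallyConstant c ∧ ∀ y, y ∈ U (c y) :=
  LocAnCoh.exists_isLocallyConstant_mem (M := Fin (Module.finrank K X.model) → K)
    (fun x => ⟨(chartAt X.model x).transHomeomorph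
      (Module.finBasis K X.model).equivFunL.toHomeomorph, mem_chart_source X.model x⟩) hU

/-- The sieve of maps to `X` along which the function `c` on `X` becomes constant. -/
def constancySieve {X : La K} {ι : Type*} (c : X.carrier → ι) : Sieve X where
  arrows _ g := ∃ i, ∀ y, c (fn g y) = i
  downward_closed := fun ⟨i, hi⟩ h => ⟨i, fun z => hi (fn h z)⟩

theorem constancySieve_mem_topology {X : La K} {ι : Type*} {c : X.carrier → ι}
    (hc : IsLocallyConstant c) : constancySieve c ∈ topology K X := by
  intro x
  obtain ⟨V, hxV, hV, hVp⟩ := X.exists_paracompact (hc.isOpen_fiber (c x)) (x := x) rfl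
  exact ⟨V, hVp, hxV, c x, fun y : V => hV y.2⟩

variable {F : (La K)ᵒᵖ ⥤ Type w}

theorem subsingleton_of_isEmpty (hF : Presieve.IsSheaf (topology K) F) (X : La K)
    [IsEmpty X.carrier] : Subsingleton (F.obj (op X)) :=
  ⟨fun _ _ => (hF ⊥ fun x => isEmptyElim x).isSeparatedFor.ext fun _ _ h => h.elim⟩

theorem map_toOpen_congr {X Y : La K} {ι : Type*} {U : ι → TopologicalSpace.Opens X.carrier}
    [∀ i, ParacompactSpace (U i)] (a : ∀ i, F.obj (op (X.openSub (U i)))) {i j : ι} (hij : i = j)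
    {g h : Y ⟶ X} (hgh : g = h) (hg : ∀ y, fn g y ∈ U i) (hh : ∀ y, fn h y ∈ U j) :
    F.map (toOpen g hg).op (a i) = F.map (toOpen h hh).op (a j) := by
  subst hij hgh
  rfl

theorem exists_glue_of_isLocallyConstant (hF : Presieve.IsSheaf (topology K) F) {X : La K}
    {ι : Type*} {c : X.carrier → ι} (hc : IsLocallyConstant c)
    {U : ι → TopologicalSpace.Opens X.carrier} [∀ i, ParacompactSpace (U i)]
    (hcU : ∀ x, x ∈ U (c x)) (a : ∀ i, F.obj (op (X.openSub (U i)))) :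
    ∃ s : F.obj (op X), ∀ {Y : La K} (g : Y ⟶ X), constancySieve c g →
      ∃ (i : ι) (hg : ∀ y, fn g y ∈ U i), F.map g.op s = F.map (toOpen g hg).op (a i) := by
  let i {Y : La K} (g : Y ⟶ X) (hg : constancySieve c g) : ι := hg.choose
  have hi {Y : La K} (g : Y ⟶ X) (hg : constancySieve c g) (y : Y.carrier) :
      c (fn g y) = i g hg := hg.choose_spec y
  have hU {Y : La K} (g : Y ⟶ X) (hg : constancySieve c g) (y : Y.carrier) : fn g y ∈ U (i g hg) :=
    hi g hg y ▸ hcU _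
  let t : Presieve.FamilyOfElements F (constancySieve c).arrows :=
    fun Y g hg => F.map (toOpen g (hU g hg)).op (a (i g hg))
  have ht : t.Compatible := by
    intro Y₁ Y₂ Z g₁ g₂ f₁ f₂ h₁ h₂ e
    rcases isEmpty_or_nonempty Z.carrier with hZ | ⟨⟨z⟩⟩
    · exact (subsingleton_of_isEmpty hF Z).elim _ _
    · have hi₁₂ : i f₁ h₁ = i f₂ h₂ := by
        rw [← hi f₁ h₁ (fn g₁ z), ← hi f₂ h₂ (fn g₂ z), ← fn_comp, e, fn_comp]
      simp only [t, ← Functor.map_comp_apply, ← op_comp, comp_toOpen]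
      exact map_toOpen_congr a hi₁₂ e _ _
  obtain ⟨s, hs, -⟩ := hF _ (constancySieve_mem_topology hc) t ht
  exact ⟨s, fun g hg => ⟨i g hg, hU g hg, hs g hg⟩⟩

/-- Local preimages glue without any cocycle obstruction over a partition into open subsets. -/
theorem app_surjective_of_epi [CompleteSpace K] [IsUltrametricDist K]
    {𝒢 : (La K)ᵒᵖ ⥤ GrpCat.{u}} {A B : EquivariantSheaf (topology K) 𝒢 AddCommGrpCat.{u + 1}}
    (f : A ⟶ B) [Epi f] (X : La K) : Function.Surjective (f.hom.hom.app (op X)) := by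
  intro b
  choose U hUp hxU a ha using EquivariantSheaf.imageSieve_mem_of_epi f b
  obtain ⟨c, hc, hcU⟩ := X.exists_isLocallyConstant_mem fun x => (U x).isOpen.mem_nhds (hxU x)
  obtain ⟨s, hs⟩ := exists_glue_of_isLocallyConstant A.isSheaf_forget hc hcU a
  refine ⟨s, (B.isSheaf_forget _ (constancySieve_mem_topology hc)).isSeparatedFor.ext
    fun Y g hg => ?_⟩
  obtain ⟨x, hgx, hsx⟩ := hs g hg
  calc B.sheaf.obj.map g.op (f.hom.hom.app (op X) s)
      = f.hom.hom.app (op Y) (A.sheaf.obj.map g.op s) :=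
        (NatTrans.naturality_apply f.hom.hom g.op s).symm
    _ = f.hom.hom.app (op Y) (A.sheaf.obj.map (toOpen g hgx).op (a x)) :=
        congrArg (f.hom.hom.app (op Y)) hsx
    _ = B.sheaf.obj.map (toOpen g hgx).op (f.hom.hom.app _ (a x)) :=
        NatTrans.naturality_apply f.hom.hom _ _
    _ = B.sheaf.obj.map (toOpen g hgx).op (B.sheaf.obj.map (X.openIncl (U x)).op b) :=
        congrArg _ (ha x)
    _ = B.sheaf.obj.map g.op b := (B.sheaf.obj.map_comp_apply _ _ b).symm

end La

end SurjectiveOnSections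

section PowersOfLieGroups

theorem firstCountableTopology_of_chartedSpace (H M : Type*) [TopologicalSpace H]
    [FirstCountableTopology H] [TopologicalSpace M] [ChartedSpace H M] :
    FirstCountableTopology M where
  nhds_generated_countable x := by
    rw [← (chartAt H x).left_inv (mem_chart_source H x), ← (chartAt H x).symm.map_nhds_eq
      ((chartAt H x).map_source (mem_chart_source H x))]
    infer_instance

theorem metrizableSpace_of_isTopologicalGroup (G : Type*) [TopologicalSpace G] [Group G]
    [IsTopologicalGroup G] [FirstCountableTopology G] [T0Space G] :
    TopologicalSpace.MetrizableSpace G := by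
  let _ := IsTopologicalGroup.rightUniformSpace G
  have : (uniformity G).IsCountablyGenerated :=
    Filter.comap.isCountablyGenerated (nhds (1 : G)) _
  exact UniformSpace.metrizableSpace

variable {K : Type*} [NontriviallyNormedField K] {ι : Type*} [Fintype ι]

theorem modelWithCorners_pi_self (E : Type*) [NormedAddCommGroup E] [NormedSpace K E] :
    ModelWithCorners.pi (fun _ : ι => 𝓘(K, E)) = 𝓘(K, ι → E) :=
  ModelWithCorners.ext rfl rfl (Set.pi_univ _) (Set.pi_univ _)

theorem isManifold_pi {E H : ι → Type*} [∀ i, NormedAddCommGroup (E i)]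
    [∀ i, NormedSpace K (E i)] [∀ i, TopologicalSpace (H i)]
    (I : ∀ i, ModelWithCorners K (E i) (H i)) (n : WithTop ℕ∞) (M : ι → Type*)
    [∀ i, TopologicalSpace (M i)] [∀ i, ChartedSpace (H i) (M i)]
    [∀ i, IsManifold (I i) n (M i)] : IsManifold (ModelWithCorners.pi I) n (∀ i, M i) := by
  refine isManifold_of_contDiffOn _ _ _ ?_
  rintro _ _ ⟨e, he, rfl⟩ ⟨e', he', rfl⟩
  refine contDiffOn_pi.2 fun i => ?_
  have h := (contDiffGroupoid n (I i)).compatible (he i trivial) (he' i trivial)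
  rw [contDiffGroupoid, mem_groupoid_of_pregroupoid] at h
  refine ContDiffOn.comp (g := I i ∘ ((e i).symm ≫ₕ e' i) ∘ (I i).symm) h.1
    (contDiff_pi.1 contDiff_id i).contDiffOn ?_
  rintro x ⟨⟨hx, hx'⟩, y, rfl⟩
  exact ⟨⟨hx i trivial, hx' i trivial⟩, y i, rfl⟩

end PowersOfLieGroups

namespace La

variable (K : Type u) [NontriviallyNormedField K] (E G : Type u) [NormedAddCommGroup E]
  [NormedSpace K E] [FiniteDimensional K E] [TopologicalSpace G] [T2Space G] [ChartedSpace E G]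
  [Group G] [LieGroup 𝓘(K, E) ω G] (ι : Type) [Fintype ι]

/-- The manifold `G^ι`. It is paracompact because Lie groups are metrizable. -/
noncomputable def power : La K where
  carrier := ι → G
  model := ι → E
  chartedSpace := piChartedSpace (fun _ => E) fun _ => G
  paracompactSpace := by
    have := topologicalGroup_of_lieGroup 𝓘(K, E) ω (G := G)
    have := firstCountableTopology_of_chartedSpace E G
    have := metrizableSpace_of_isTopologicalGroup G
    let _ := TopologicalSpace.metrizableSpaceMetric (ι → G)
    infer_instance
  isManifold := modelWithCorners_pi_self (K := K) (ι := ι) E ▸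
    isManifold_pi (fun _ : ι => 𝓘(K, E)) ω fun _ => G

variable {K E G ι}

theorem contMDiff_power_iff {E' H M : Type*} [NormedAddCommGroup E'] [NormedSpace K E']
    [TopologicalSpace H] [TopologicalSpace M] [ChartedSpace H M] {I : ModelWithCorners K E' H}
    {f : M → (power K E G ι).carrier} :
    ContMDiff I (power K E G ι).I ω f ↔
      ∀ i, ContMDiff I 𝓘(K, E) ω fun x => (f x : ι → G) i := by
  have h := contMDiff_pi_manifold (I := I) (I' := fun _ : ι => 𝓘(K, E)) (f := (f : M → ι → G))
  rwa [modelWithCorners_pi_self] at h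

theorem isAnalytic_power_iff {V : Type u} [AddCommGroup V] [Module K V] [TopologicalSpace V]
    {f : (ι → G) → V} :
    IsAnalytic (M := (power K E G ι).carrier) (power K E G ι).I f ↔
      IsAnalytic (ModelWithCorners.pi fun _ : ι => 𝓘(K, E)) f := by
  rw [modelWithCorners_pi_self]
  rfl

variable (K E G ι) in
/-- The manifold `G^ι` represents the `ι`-th power of `y(G)`. -/
noncomputable def powerRepresentableBy :
    (powerPresheaf (yG K E G) ι).RepresentableBy (power K E G ι) where
  homEquiv {X} :=
    { toFun f i := ⟨fun p => (fn f p : ι → G) i, contMDiff_power_iff.1 (fn f).contMDiff i⟩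
      invFun (x : ι → C^ω⟮X.I, X.carrier; 𝓘(K, E), G⟯) :=
        ⟨fun p i => x i p, contMDiff_power_iff.2 fun i => (x i).contMDiff⟩
      left_inv _ := rfl
      right_inv _ := rfl }
  homEquiv_comp _ _ := rfl

end La

section Scalars

open HomologicalComplex

variable {K : Type u} [CommRing K]

variable (K) in
/-- The underlying abelian group of a module, in a larger universe. -/
abbrev uliftAbelianGroup : ModuleCat.{u} K ⥤ AddCommGrpCat.{max u v} :=
  forget₂ (ModuleCat.{u} K) AddCommGrpCat.{u} ⋙ AddCommGrpCat.uliftFunctor.{v, u}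

variable {C : CochainComplex (ModuleCat.{u} K) ℕ} {D : CochainComplex AddCommGrpCat.{max u v} ℕ}

/-- The isomorphism in cohomology induced by an isomorphism of a complex of abelian groups with the
underlying complex of a complex of modules. -/
noncomputable def homologyAddEquiv
    (φ : D ≅ ((uliftAbelianGroup.{v, u} K).mapHomologicalComplex _).obj C) (i : ℕ) :
    D.homology i ≃+ C.homology i :=
  ((homologyFunctor _ _ i).mapIso φ ≪≫
    (C.sc i).mapHomologyIso (uliftAbelianGroup K)).addCommGroupIsoToAddEquiv.trans AddEquiv.ulift

theorem homologyMap_smul_id (C : CochainComplex (ModuleCat.{u} K) ℕ) (c : K) (i : ℕ) :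
    homologyMap (c • 𝟙 C) i = c • 𝟙 (C.homology i) :=
  (ShortComplex.homologyMap_smul ((shortComplexFunctor _ _ i).map (𝟙 C)) c).trans
    (congrArg (c • ·) (homologyMap_id C i))

theorem homologyAddEquiv_homologyMap
    (φ : D ≅ ((uliftAbelianGroup.{v, u} K).mapHomologicalComplex _).obj C) {c : K} {f : D ⟶ D}
    (hf : f ≫ φ.hom = φ.hom ≫ ((uliftAbelianGroup K).mapHomologicalComplex _).map (c • 𝟙 C))
    (i : ℕ) (x : D.homology i) :
    homologyAddEquiv φ i (homologyMap f i x) = c • homologyAddEquiv φ i x := by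
  let ψ : (((uliftAbelianGroup.{v, u} K).mapHomologicalComplex _).obj C).homology i ≅
      (uliftAbelianGroup K).obj (C.homology i) := (C.sc i).mapHomologyIso (uliftAbelianGroup K)
  have naturality : homologyMap (((uliftAbelianGroup.{v, u} K).mapHomologicalComplex _).map
      (c • 𝟙 C)) i ≫ ψ.hom = ψ.hom ≫ (uliftAbelianGroup K).map (c • 𝟙 (C.homology i)) := by
    rw [← homologyMap_smul_id]
    exact ShortComplex.mapHomologyIso_hom_naturality
      ((shortComplexFunctor _ _ i).map (c • 𝟙 C)) (uliftAbelianGroup K)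
  have comm : homologyMap f i ≫ homologyMap φ.hom i ≫ ψ.hom =
      (homologyMap φ.hom i ≫ ψ.hom) ≫ (uliftAbelianGroup K).map (c • 𝟙 (C.homology i)) := by
    rw [← homologyMap_comp_assoc, hf, homologyMap_comp_assoc, naturality, Category.assoc]
  exact congrArg ULift.down (ConcreteCategory.congr_hom comm x)

end Scalars

section Comparison

open AlgebraicTopology

variable {K : Type u} [NontriviallyNormedField K]
variable {E G : Type u} [NormedAddCommGroup E] [NormedSpace K E]
  [TopologicalSpace G] [ChartedSpace E G] [Group G] [LieGroup 𝓘(K, E) ω G]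
variable {V : Type u} [AddCommGroup V] [Module K V] [TopologicalSpace V]
  [IsTopologicalAddGroup V] [T2Space V]
variable {ρ : G →* (V ≃L[K] V)} {ι : Type} [Fintype ι]

/-- The admissible function `p ↦ f (x p)` given by a cochain `f` and a family `x` of analytic maps
to `G`. -/
def cochainPullback {X : La K} (x : ι → C^ω⟮X.I, X.carrier; 𝓘(K, E), G⟯) (f : cochains E ρ ι) :
    admissible E ρ X where
  val p := f.1 fun i => x i p
  property := by
    refine ⟨f.2.1.comp (contMDiff_pi_manifold.2 fun i => (x i).contMDiff), ?_⟩
    simp_rw [← f.2.2]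
    exact f.2.1.comp (contMDiff_pi_manifold.2 fun i =>
      contMDiff_fst.mul ((x i).contMDiff.comp contMDiff_snd))

/-- The homogeneous cochain with values in `V̲` given by an equivariant analytic function. -/
def ofCochain (f : cochains E ρ ι) :
    freePresheaf (Twist.tuples (yG K E G) ι) ⟶ (admissibleSheaf E ρ).toPresheaf :=
  freePresheafHomEquiv.symm
    { app Y := ↾fun x : ULift (ι → C^ω⟮Y.unop.base.I, Y.unop.base.carrier; 𝓘(K, E), G⟯) =>
        ULift.up.{u + 1} (cochainPullback x.down f)
      naturality Y Z g := by
        refine ConcreteCategory.hom_ext _ _ fun x => ?_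
        apply ULift.down_injective
        apply Subtype.ext
        funext p
        exact f.2.2 _ _ }

theorem ofCochain_app_of (f : cochains E ρ ι) (Y : (Twist (yG K E G))ᵒᵖ)
    (x : (Twist.tuples (yG K E G) ι).obj Y) :
    (ofCochain f).app Y (FreeAbelianGroup.of x) =
      ULift.up.{u + 1} (cochainPullback (X := Y.unop.base) x.down f) :=
  freePresheafHomEquiv_symm_app_of _ Y x

variable [FiniteDimensional K E] [T2Space G]

variable (K E G ι) in
/-- The universal section of `y(G)^ι`, namely the identity of `G^ι`, over the twisted site. -/
noncomputable def universalTuple :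
    (Twist.tuples (yG K E G) ι).obj (op ⟨La.power K E G ι⟩) :=
  ULift.up.{u + 1} ((La.powerRepresentableBy K E G ι).homEquiv (𝟙 _))

/-- The value of a homogeneous cochain with values in `V̲` on the identity of `G^ι`. -/
noncomputable def cochainValue
    (φ : freePresheaf (Twist.tuples (yG K E G) ι) ⟶ (admissibleSheaf E ρ).toPresheaf) :
    admissible E ρ (La.power K E G ι) :=
  (φ.app (op ⟨La.power K E G ι⟩) (FreeAbelianGroup.of (universalTuple K E G ι)) :
    ULift.{u + 1} (admissible E ρ (La.power K E G ι))).down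

theorem app_of_mul_apply
    (φ : freePresheaf (Twist.tuples (yG K E G) ι) ⟶ (admissibleSheaf E ρ).toPresheaf)
    {X : La K} (g : C^ω⟮X.I, X.carrier; 𝓘(K, E), G⟯)
    (x : ι → C^ω⟮X.I, X.carrier; 𝓘(K, E), G⟯) (p : X.carrier) :
    (φ.app (op ⟨X⟩) (FreeAbelianGroup.of (ULift.up.{u + 1} fun i => g * x i)) :
      ULift.{u + 1} (admissible E ρ X)).down.1 p =
    ρ (g p) ((cochainValue φ).1 fun i => x i p) := by
  let f : (⟨X⟩ : Twist (yG K E G)) ⟶ ⟨La.power K E G ι⟩ :=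
    Twist.homMk ((La.powerRepresentableBy K E G ι).homEquiv.symm x) g
  exact congrArg (fun s : ULift.{u + 1} (admissible E ρ X) => s.down.1 p)
    (ConcreteCategory.congr_hom (φ.naturality f.op)
      (FreeAbelianGroup.of (universalTuple K E G ι)))

theorem app_of_apply
    (φ : freePresheaf (Twist.tuples (yG K E G) ι) ⟶ (admissibleSheaf E ρ).toPresheaf)
    {X : La K} (x : ι → C^ω⟮X.I, X.carrier; 𝓘(K, E), G⟯) (p : X.carrier) :
    (φ.app (op ⟨X⟩) (FreeAbelianGroup.of (ULift.up.{u + 1} x)) :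
      ULift.{u + 1} (admissible E ρ X)).down.1 p = (cochainValue φ).1 fun i => x i p := by
  have h := app_of_mul_apply φ 1 x p
  simp only [one_mul] at h
  exact h.trans (DFunLike.congr_fun (map_one ρ) _)

theorem cochainValue_mem_cochains
    (φ : freePresheaf (Twist.tuples (yG K E G) ι) ⟶ (admissibleSheaf E ρ).toPresheaf) :
    (cochainValue φ).1 ∈ cochains E ρ ι := by
  refine ⟨La.isAnalytic_power_iff.1 (cochainValue φ).2.1, fun g x => ?_⟩
  let X := La.power K E G ι
  let c : C^ω⟮X.I, X.carrier; 𝓘(K, E), G⟯ := ⟨fun _ => g, contMDiff_const⟩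
  let y : ι → C^ω⟮X.I, X.carrier; 𝓘(K, E), G⟯ := (universalTuple K E G ι).down
  exact (app_of_apply φ (fun i => c * y i) x).symm.trans (app_of_mul_apply φ c y x)

theorem cochainValue_ofCochain (f : cochains E ρ ι) : (cochainValue (ofCochain f)).1 = f.1 := by
  rw [cochainValue, ofCochain_app_of]
  rfl

/-- Homogeneous cochains with values in `V̲` are the equivariant analytic functions. -/
noncomputable def homogeneousCochainsEquiv (ρ : G →* (V ≃L[K] V)) (ι : Type) [Fintype ι] :
    (freePresheaf (Twist.tuples (yG K E G) ι) ⟶ (admissibleSheaf E ρ).toPresheaf) ≃+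
      cochains E ρ ι where
  toFun φ := ⟨(cochainValue φ).1, cochainValue_mem_cochains φ⟩
  invFun := ofCochain
  left_inv φ := freePresheaf_hom_ext fun Y x => by
    refine (ofCochain_app_of _ Y x).trans ?_
    apply ULift.down_injective
    apply Subtype.ext
    funext p
    exact (app_of_apply φ (X := Y.unop.base) x.down p).symm
  right_inv f := Subtype.ext (cochainValue_ofCochain f)
  map_add' _ _ := rfl

/-- The homogeneous cochains with values in `V̲` and the analytic cochains are isomorphic as
cosimplicial groups. -/
noncomputable def cosimplicialCochainsIso (ρ : G →* (V ≃L[K] V)) :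
    ((Twist.freeTuples (yG K E G)).rightOp ⋙ preadditiveCoyoneda).flip.obj
        (admissibleSheaf E ρ).toPresheaf ≅
      ((CosimplicialObject.whiskering _ _).obj (uliftAbelianGroup.{u + 1, u} K)).obj
        (cosimplicialCochains E ρ) :=
  NatIso.ofComponents
    (fun n => ((homogeneousCochainsEquiv ρ (Fin (n.len + 1))).trans
      AddEquiv.ulift.symm).toAddCommGrpIso)
    fun {m n} s => by
      refine ConcreteCategory.hom_ext _ _ fun φ => ?_
      apply ULift.down_injective
      apply Subtype.ext
      funext x
      exact app_of_apply (X := La.power K E G (Fin (n.len + 1))) φ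
        (fun i => (universalTuple K E G (Fin (n.len + 1))).down (s.toOrderHom i)) x

/-- The complex of homogeneous cochains with values in `V̲` is the complex of analytic cochains. -/
noncomputable def homogeneousComplexIso (ρ : G →* (V ≃L[K] V)) :
    (EquivariantSheaf.homogeneousComplex (La.topology K) (yG K E G)).obj (admissibleSheaf E ρ) ≅
      ((uliftAbelianGroup.{u + 1, u} K).mapHomologicalComplex _).obj (cochainComplex E ρ) :=
  (alternatingCofaceMapComplex _).mapIso (cosimplicialCochainsIso ρ) ≪≫
    (mapAlternatingCofaceMapComplexIso _ _).symm

theorem homogeneousComplexIso_smul (ρ : G →* (V ≃L[K] V)) (c : K) :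
    (EquivariantSheaf.homogeneousComplex (La.topology K) (yG K E G)).map
        (admissibleSheafSMul E ρ c) ≫ (homogeneousComplexIso ρ).hom =
      (homogeneousComplexIso ρ).hom ≫
        ((uliftAbelianGroup.{u + 1, u} K).mapHomologicalComplex _).map
          (c • 𝟙 (cochainComplex E ρ)) := by
  ext n φ
  rfl

end Comparison

end LocAnCoh

theorem mainTheorem5_general {K : Type u} [NontriviallyNormedField K] [CompleteSpace K]
    [IsUltrametricDist K]
    {E : Type u} [NormedAddCommGroup E] [NormedSpace K E] [FiniteDimensional K E]
    {G : Type u} [TopologicalSpace G] [T2Space G] [ChartedSpace E G] [Group G]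
    [LieGroup 𝓘(K, E) ω G]
    {V : Type u} [AddCommGroup V] [Module K V] [TopologicalSpace V] [IsTopologicalAddGroup V]
    [T2Space V] (ρ : G →* (V ≃L[K] V)) (i : ℕ) :
    ∃ e : LocAnCoh.Han E ρ i ≃+ (LocAnCoh.cochainComplex E ρ).homology i,
      ∀ (c : K) (x : LocAnCoh.Han E ρ i), e (LocAnCoh.HanSMul E ρ i c x) = c • e x := by
  let ψ := LocAnCoh.EquivariantSheaf.cohomologyIso
    (fun n => LocAnCoh.La.powerRepresentableBy K E G (Fin (n + 1)))
    (fun f _ _ => LocAnCoh.La.app_surjective_of_epi f _) i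
  let φ := LocAnCoh.homogeneousComplexIso (E := E) ρ
  refine ⟨(ψ.app (LocAnCoh.admissibleSheaf E ρ)).addCommGroupIsoToAddEquiv.trans
    (LocAnCoh.homologyAddEquiv φ i), fun c x => ?_⟩
  have naturality := ConcreteCategory.congr_hom
    (ψ.hom.naturality (LocAnCoh.admissibleSheafSMul E ρ c)) x
  exact (congrArg (LocAnCoh.homologyAddEquiv φ i) naturality).trans
    (LocAnCoh.homologyAddEquiv_homologyMap φ (LocAnCoh.homogeneousComplexIso_smul ρ c) i _)

theorem mainTheorem5 {K : Type u} [NontriviallyNormedField K] [CompleteSpace K]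
    [IsUltrametricDist K] [CharZero K]
    {E : Type u} [NormedAddCommGroup E] [NormedSpace K E] [FiniteDimensional K E]
    {G : Type u} [TopologicalSpace G] [T2Space G] [ChartedSpace E G] [Group G]
    [LieGroup 𝓘(K, E) ω G]
    {V : Type u} [AddCommGroup V] [Module K V] [TopologicalSpace V] [IsTopologicalAddGroup V]
    [ContinuousSMul K V] [T2Space V] [IsLinearTopology (NormedField.valuation (K := K)).integer V]
    (ρ : G →* (V ≃L[K] V)) (hρ : LocAnCoh.IsLocallyAnalyticRep E ρ) (i : ℕ) :
    ∃ e : LocAnCoh.Han E ρ i ≃+ (LocAnCoh.cochainComplex E ρ).homology i,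
      ∀ (c : K) (x : LocAnCoh.Han E ρ i), e (LocAnCoh.HanSMul E ρ i c x) = c • e x :=
  mainTheorem5_general ρ i
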